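/- Let $\Theta \subseteq \mathbb{R}^d$ be open and let $(p_\theta)_{\theta \in \Theta}$ be probability densities with respect to a measure $\mu$. The family is differentiable in quadratic mean (DQM) at $\theta$ with score $\dot\ell_\theta : \mathcal X \to \mathbb{R}^d$ if $$\int \Bigl( \sqrt{p_{\theta+h}} - \sqrt{p_\theta} - \tfrac12 h^T \dot\ell_\theta \sqrt{p_\theta} \Bigr)^2 d\mu = o(\|h\|^2) \quad (h \to 0),$$ and it is doubly differentiable in quadratic mean (DDQM) at $\theta$, with scores $\dot\ell_{\theta'}$, if for all sequences $h, \tilde h \to 0$ $$\int \Bigl( \sqrt{p_{\theta+h}} - \sqrt{p_{\theta+\tilde h}} - \tfrac12 (h-\tilde h)^T \dot\ell_{\theta+\tilde h} \sqrt{p_{\theta+\tilde h}} \Bigr)^2 d\mu = o(\|h-\tilde h\|^2).$$ Write $I(\theta) = \int \dot\ell_\theta \dot\ell_\theta^T p_\theta \, d\mu$ for the Fisher information of one observation. **Theorem.** Let $\theta \in \Theta$. Suppose that the family is DQM with score $\dot\ell_{\theta'}$ at every $\theta'$ in some neighbourhood of $\theta$, and that, with these scores, it is DDQM at $\theta$.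 Let $h_n, \tilde h_n \to 0$ be sequences with $\theta + h_n, \theta + \tilde h_n \in \Theta$ and $\sqrt n\,(h_n - \tilde h_n) \to k$. For each $n$ let $X_1, \dots, X_n$ be independent with common density $p_{\theta + \tilde h_n}$, and put $\ell(\theta') = \sum_{i=1}^n \log p_{\theta'}(X_i)$ and $\dot\ell(\theta') = \sum_{i=1}^n \dot\ell_{\theta'}(X_i)$. Then, under the law of this sample, with probability tending to $1$ all the $p_{\theta+h_n}(X_i)$ and $p_{\theta+\tilde h_n}(X_i)$ are positive (so that $\ell(\theta+h_n)$ and $\ell(\theta+\tilde h_n)$ are finite), and $$\ell(\theta + h_n) - \ell(\theta + \tilde h_n) = \frac{1}{\sqrt n}\, k^T \dot\ell(\theta + \tilde h_n) - \frac12 k^T I(\theta) k + o_p(1),$$ $$\ell(\theta + h_n) - \ell(\theta + \tilde h_n) \longrightarrow^d N\Bigl(-\tfrac12 k^T I(\theta) k,\; k^T I(\theta) k\Bigr),$$ where $N(0,0)$ is the point mass at $0$, and where the value given to $\log 0$ is immaterial. -/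

import Mathlib

open MeasureTheory ProbabilityTheory Filter Asymptotics
open scoped Topology Matrix

noncomputable section

namespace LocalAsymptotics

variable {𝒳 : Type*} [MeasurableSpace 𝒳] {d : ℕ}

/-- `p θ`, for `θ ∈ Θ`, is a probability density with respect to `μ`. -/
structure IsDensityFamily (μ : Measure 𝒳) (Θ : Set (EuclideanSpace ℝ (Fin d)))
    (p : EuclideanSpace ℝ (Fin d) → 𝒳 → ℝ) : Prop where
  measurable : ∀ θ ∈ Θ, Measurable (p θ)
  nonneg : ∀ θ ∈ Θ, ∀ x, 0 ≤ p θ x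
  lintegral_eq_one : ∀ θ ∈ Θ, ∫⁻ x, ENNReal.ofReal (p θ x) ∂μ = 1

/-- The distribution `P_θ` with density `p θ` with respect to `μ`. -/
def law (μ : Measure 𝒳) (p : EuclideanSpace ℝ (Fin d) → 𝒳 → ℝ)
    (θ : EuclideanSpace ℝ (Fin d)) : Measure 𝒳 :=
  μ.withDensity fun x => ENNReal.ofReal (p θ x)

/-- The remainder `√p_{θ₁} - √p_{θ₀} - ½ (θ₁ - θ₀)ᵀ s √p_{θ₀}` of the first order expansion of
the root density around `θ₀`, where `s` is a candidate for the score at `θ₀`. -/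
def rootRemainder (p : EuclideanSpace ℝ (Fin d) → 𝒳 → ℝ) (s : 𝒳 → EuclideanSpace ℝ (Fin d))
    (θ₀ θ₁ : EuclideanSpace ℝ (Fin d)) (x : 𝒳) : ℝ :=
  √(p θ₁ x) - √(p θ₀ x) - (1 / 2) * inner ℝ (θ₁ - θ₀) (s x) * √(p θ₀ x)

/-- The family `p` is differentiable in quadratic mean at `θ`, with score `s`:
`∫ (√p_{θ+h} - √p_θ - ½ hᵀ s √p_θ)² dμ = o(‖h‖²)` as `h → 0`.
(The integrability clause says that the integral is finite for small `h`.) -/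
def HasDQMScore (μ : Measure 𝒳) (p : EuclideanSpace ℝ (Fin d) → 𝒳 → ℝ)
    (s : 𝒳 → EuclideanSpace ℝ (Fin d)) (θ : EuclideanSpace ℝ (Fin d)) : Prop :=
  (∀ᶠ h in 𝓝 (0 : EuclideanSpace ℝ (Fin d)),
      Integrable (fun x => rootRemainder p s θ (θ + h) x ^ 2) μ) ∧
    (fun h : EuclideanSpace ℝ (Fin d) => ∫ x, rootRemainder p s θ (θ + h) x ^ 2 ∂μ)
      =o[𝓝 0] fun h => ‖h‖ ^ 2

/-- The family `p` with score function `score` is doubly differentiable in quadratic mean at `θ`: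
for all sequences `h, h' → 0`,
`∫ (√p_{θ+h} - √p_{θ+h'} - ½ (h-h')ᵀ score(θ+h') √p_{θ+h'})² dμ = o(‖h-h'‖²)`.
(The integrability clause says that the integral is eventually finite.) -/
def IsDDQM (μ : Measure 𝒳) (p : EuclideanSpace ℝ (Fin d) → 𝒳 → ℝ)
    (score : EuclideanSpace ℝ (Fin d) → 𝒳 → EuclideanSpace ℝ (Fin d))
    (θ : EuclideanSpace ℝ (Fin d)) : Prop :=
  ∀ h h' : ℕ → EuclideanSpace ℝ (Fin d), Tendsto h atTop (𝓝 0) → Tendsto h' atTop (𝓝 0) →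
    (∀ᶠ n in atTop,
      Integrable (fun x => rootRemainder p (score (θ + h' n)) (θ + h' n) (θ + h n) x ^ 2) μ) ∧
    (fun n => ∫ x, rootRemainder p (score (θ + h' n)) (θ + h' n) (θ + h n) x ^ 2 ∂μ)
      =o[atTop] fun n => ‖h n - h' n‖ ^ 2

/-- The Fisher information matrix of one observation, `I(θ) = E_θ[score(θ) score(θ)ᵀ]`. -/
def fisherInfo (μ : Measure 𝒳) (p : EuclideanSpace ℝ (Fin d) → 𝒳 → ℝ)
    (score : EuclideanSpace ℝ (Fin d) → 𝒳 → EuclideanSpace ℝ (Fin d))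
    (θ : EuclideanSpace ℝ (Fin d)) : Matrix (Fin d) (Fin d) ℝ :=
  Matrix.of fun i j => ∫ x, score θ x i * score θ x j ∂(law μ p θ)

/-- The quadratic form `kᵀ A k`. -/
def quadForm (A : Matrix (Fin d) (Fin d) ℝ) (k : EuclideanSpace ℝ (Fin d)) : ℝ :=
  k.ofLp ⬝ᵥ (A *ᵥ k.ofLp)

/-- The log-likelihood `ℓ(θ) = ∑ᵢ log p_θ(xᵢ)` of a sample `x₁, …, xₙ`
(a genuine value only when all the `p_θ(xᵢ)` are positive). -/
def logLik (p : EuclideanSpace ℝ (Fin d) → 𝒳 → ℝ) {n : ℕ} (x : Fin n → 𝒳)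
    (θ : EuclideanSpace ℝ (Fin d)) : ℝ :=
  ∑ i, Real.log (p θ (x i))

/-- The score of a sample `x₁, …, xₙ`: the sum of the scores of the observations. -/
def sampleScore (score : EuclideanSpace ℝ (Fin d) → 𝒳 → EuclideanSpace ℝ (Fin d)) {n : ℕ}
    (x : Fin n → 𝒳) (θ : EuclideanSpace ℝ (Fin d)) : EuclideanSpace ℝ (Fin d) :=
  ∑ i, score θ (x i)

/-- `R n = o_p(1)`, where `R n` is defined on the probability space `(Ω n, P n)`. -/
def IsLittleOInProb {Ω : ℕ → Type*} [∀ n, MeasurableSpace (Ω n)] (P : ∀ n, Measure (Ω n))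
    (R : ∀ n, Ω n → ℝ) : Prop :=
  ∀ ε : ℝ, 0 < ε → Tendsto (fun n => P n {ω | ε ≤ |R n ω|}) atTop (𝓝 0)

end LocalAsymptotics

end

/-! Everything happens for root densities in `L²(μ)`. Put `f n = 2√n (√p_{θ+h n} - √p_{θ+h' n})` and
`g = kᵀ score_θ √p_θ`. Double differentiability gives `f n → g` in `L²` (`IsDDQM.tendsto_sqrt_sub`),
once the scores themselves are known to be `L²`-continuous along `h'` (`IsDDQM.tendsto_score`); and
`‖g‖² = kᵀ I(θ) k`.

Let `w` be the relative root increment `2 (√(p_{θ+h n} / p_{θ+h' n}) - 1)`, under the law with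
density `p_{θ+h' n}`. Where `|w| ≤ 1` the log-likelihood ratio of one observation is `2 log (1 +
w/2) = w - w²/4 + o(w²)`. The main tool, `tendsto_integral_sq_smul_comp`, says that `n E F(w) → A
‖g‖²` whenever `F` is bounded by a multiple of `w²` and `F(w) = A w² + o(w²)`. The linear term is
not of this kind, but its mean is exact: root densities are unit vectors, so `n E w = -‖f n‖² / 4 →
-‖g‖² / 4`. Together with the `-w²/4` of the logarithm this produces the centring `-‖g‖² / 2`.

Both conclusions follow from suitable choices of `F`. The indicator of `|w| > 1` shows that
truncation matters with vanishing probability. First and second moments of the truncated logarithm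
minus its linear approximation give the expansion by Chebyshev, the score having mean zero. Finally
`exp (itT(w)) - 1 - itw`, with `T` the truncated logarithm, gives the limiting characteristic
function directly, with no separate central limit theorem. -/

namespace LocalAsymptotics

/-! ### Convergence of products and squares in `L²`. -/

section SquareIntegrable

variable {α ι : Type*} [MeasurableSpace α] {μ : Measure α} {l : Filter ι}

lemma eLpNorm_mul_le_two {u v : α → ℝ} (hu : AEStronglyMeasurable u μ)
    (hv : AEStronglyMeasurable v μ) :
    eLpNorm (fun x => u x * v x) 1 μ ≤ eLpNorm u 2 μ * eLpNorm v 2 μ := by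
  have h := eLpNorm_smul_le_mul_eLpNorm (p := 2) (q := 2) (r := 1) hv hu
  exact h

lemma eventually_memLp_of_tendsto {u : ι → α → ℝ} {u₀ : α → ℝ}
    (hu : ∀ᶠ n in l, AEStronglyMeasurable (u n) μ) (hu₀ : MemLp u₀ 2 μ)
    (hlim : Tendsto (fun n => eLpNorm (u n - u₀) 2 μ) l (𝓝 0)) :
    ∀ᶠ n in l, MemLp (u n) 2 μ := by
  filter_upwards [hu, hlim.eventually_lt_const ENNReal.zero_lt_top] with n hn hn'
  have : MemLp (u n - u₀) 2 μ := ⟨hn.sub hu₀.1, hn'⟩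
  simpa using this.add hu₀

/-- Products of `L²`-convergent functions converge in `L¹`. -/
lemma tendsto_eLpNorm_mul_sub {u v : ι → α → ℝ} {u₀ v₀ : α → ℝ}
    (hu : ∀ᶠ n in l, AEStronglyMeasurable (u n) μ) (hv : ∀ᶠ n in l, AEStronglyMeasurable (v n) μ)
    (hu₀ : MemLp u₀ 2 μ) (hv₀ : MemLp v₀ 2 μ)
    (hul : Tendsto (fun n => eLpNorm (u n - u₀) 2 μ) l (𝓝 0))
    (hvl : Tendsto (fun n => eLpNorm (v n - v₀) 2 μ) l (𝓝 0)) :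
    Tendsto (fun n => eLpNorm ((fun x => u n x * v n x) - fun x => u₀ x * v₀ x) 1 μ) l (𝓝 0) := by
  have key : Tendsto (fun n => eLpNorm (u n - u₀) 2 μ * eLpNorm (v n - v₀) 2 μ
      + eLpNorm u₀ 2 μ * eLpNorm (v n - v₀) 2 μ
      + eLpNorm (u n - u₀) 2 μ * eLpNorm v₀ 2 μ) l (𝓝 0) := by
    have h1 := ENNReal.Tendsto.mul hul (Or.inr ENNReal.zero_ne_top) hvl
      (Or.inr ENNReal.zero_ne_top)
    have h2 := ENNReal.Tendsto.const_mul hvl (Or.inr hu₀.2.ne)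
    have h3 := ENNReal.Tendsto.mul_const hul (Or.inr hv₀.2.ne)
    simpa using (h1.add h2).add h3
  refine tendsto_of_tendsto_of_tendsto_of_le_of_le' tendsto_const_nhds key
    (Eventually.of_forall fun _ => zero_le) ?_
  filter_upwards [hu, hv] with n hun hvn
  have hu' := hun.sub hu₀.1
  have hv' := hvn.sub hv₀.1
  have e : ((fun x => u n x * v n x) - fun x => u₀ x * v₀ x) =
      (fun x => (u n - u₀) x * (v n - v₀) x) + (fun x => u₀ x * (v n - v₀) x)
        + fun x => (u n - u₀) x * v₀ x := by
    ext x; simp only [Pi.sub_apply, Pi.add_apply]; ring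
  rw [e]
  refine (eLpNorm_add_le ((hu'.mul hv').add (hu₀.1.mul hv')) (hu'.mul hv₀.1) le_rfl).trans ?_
  refine add_le_add ((eLpNorm_add_le (hu'.mul hv') (hu₀.1.mul hv') le_rfl).trans ?_)
    (eLpNorm_mul_le_two hu' hv₀.1)
  exact add_le_add (eLpNorm_mul_le_two hu' hv') (eLpNorm_mul_le_two hu₀.1 hv')

lemma tendsto_integral_mul_of_eLpNorm {u v : ι → α → ℝ} {u₀ v₀ : α → ℝ}
    (hu : ∀ᶠ n in l, AEStronglyMeasurable (u n) μ) (hv : ∀ᶠ n in l, AEStronglyMeasurable (v n) μ)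
    (hu₀ : MemLp u₀ 2 μ) (hv₀ : MemLp v₀ 2 μ)
    (hul : Tendsto (fun n => eLpNorm (u n - u₀) 2 μ) l (𝓝 0))
    (hvl : Tendsto (fun n => eLpNorm (v n - v₀) 2 μ) l (𝓝 0)) :
    Tendsto (fun n => ∫ x, u n x * v n x ∂μ) l (𝓝 (∫ x, u₀ x * v₀ x ∂μ)) := by
  refine tendsto_integral_of_L1' _ (hu₀.1.mul hv₀.1) ?_
    (tendsto_eLpNorm_mul_sub hu hv hu₀ hv₀ hul hvl)
  filter_upwards [eventually_memLp_of_tendsto hu hu₀ hul,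
    eventually_memLp_of_tendsto hv hv₀ hvl] with n h1 h2
  exact h1.integrable_mul h2

lemma tendsto_eLpNorm_two_iff_integral_sq {u : ι → α → ℝ}
    (hu : ∀ᶠ n in l, MemLp (u n) 2 μ) :
    Tendsto (fun n => eLpNorm (u n) 2 μ) l (𝓝 0) ↔
      Tendsto (fun n => ∫ x, u n x ^ 2 ∂μ) l (𝓝 0) := by
  have e : ∀ᶠ n in l, eLpNorm (u n) 2 μ = ENNReal.ofReal (√(∫ x, u n x ^ 2 ∂μ)) := by
    filter_upwards [hu] with n hn
    rw [hn.eLpNorm_eq_integral_rpow_norm (by simp) (by simp), Real.sqrt_eq_rpow]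
    simp
  rw [tendsto_congr' e]
  constructor
  · intro h
    have h' := (ENNReal.tendsto_toReal ENNReal.zero_ne_top).comp h
    have h2 := h'.pow 2
    simp only [ENNReal.toReal_zero, ne_eq, OfNat.ofNat_ne_zero, not_false_eq_true, zero_pow] at h2
    refine h2.congr fun n => ?_
    simp only [Function.comp_apply]
    rw [ENNReal.toReal_ofReal (Real.sqrt_nonneg _),
      Real.sq_sqrt (integral_nonneg fun x => sq_nonneg _)]
  · intro h
    have := ENNReal.tendsto_ofReal ((Real.continuous_sqrt.tendsto _).comp h)
    simpa using this

end SquareIntegrable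

/-! ### Integrals of quadratically bounded functions of small increments. -/

section Core

variable {α : Type*} [MeasurableSpace α] {μ : Measure α}
  {E : Type*} [NormedAddCommGroup E] [NormedSpace ℝ E]

/-- If `aₙ uₙ rₙ → g` and `rₙ → r₀` in `L²`, where `aₙ → ∞` and `g` vanishes with `r₀`, then along
a subsequence `uₙ → 0` almost everywhere on `{g ≠ 0}`. -/
lemma exists_subseq_ae_tendsto_zero {a : ℕ → ℝ} (ha : Tendsto a atTop atTop)
    {r u : ℕ → α → ℝ} {r₀ g : α → ℝ}
    (hr : ∀ n, Measurable (r n)) (hu : ∀ n, Measurable (u n))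
    (hr₀ : MemLp r₀ 2 μ) (hg : MemLp g 2 μ) (hgr : ∀ x, r₀ x = 0 → g x = 0)
    (hrl : Tendsto (fun n => eLpNorm (r n - r₀) 2 μ) atTop (𝓝 0))
    (hfl : Tendsto (fun n => eLpNorm ((fun x => a n * u n x * r n x) - g) 2 μ) atTop (𝓝 0)) :
    ∃ ns : ℕ → ℕ, StrictMono ns ∧
      ∀ᵐ x ∂μ, g x ≠ 0 → Tendsto (fun n => u (ns n) x) atTop (𝓝 0) := by
  have m1 := tendstoInMeasure_of_tendsto_eLpNorm (by simp) (fun n => (hr n).aestronglyMeasurable)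
    hr₀.1 hrl
  obtain ⟨ns, hns, hns'⟩ := m1.exists_seq_tendsto_ae
  have hf : ∀ n, Measurable (fun x => a n * u n x * r n x) := fun n =>
    ((hu n).const_mul _).mul (hr n)
  have m2 := tendstoInMeasure_of_tendsto_eLpNorm (by simp)
    (fun n => (hf (ns n)).aestronglyMeasurable) hg.1 (hfl.comp hns.tendsto_atTop)
  obtain ⟨ms, hms, hms'⟩ := m2.exists_seq_tendsto_ae
  refine ⟨ns ∘ ms, hns.comp hms, ?_⟩
  filter_upwards [hns', hms'] with x h1 h2 hgx
  have hrx : r₀ x ≠ 0 := fun h => hgx (hgr x h)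
  have h1' := h1.comp hms.tendsto_atTop
  have ha' := ha.comp (hns.comp hms).tendsto_atTop
  -- Here `u = (a u r) · r⁻¹ · a⁻¹`, with limit `g · r₀⁻¹ · 0`.
  have h3 := (h2.mul (h1'.inv₀ hrx)).mul ha'.inv_tendsto_atTop
  rw [mul_zero] at h3
  refine h3.congr' ?_
  filter_upwards [h1'.eventually_ne hrx, ha'.eventually_ne_atTop 0] with n hn hn'
  simp only [Function.comp_apply, Pi.inv_apply] at hn hn' ⊢
  field_simp

/-- The integrals `aₙ² ∫ F(uₙ) rₙ² dμ` converge to `A ∫ g²` for functions `F` that are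
quadratically bounded, with `F(w) = A w² + o(w²)` at `0`. -/
lemma tendsto_integral_sq_smul_comp [CompleteSpace E] {a : ℕ → ℝ} (ha : Tendsto a atTop atTop)
    {r u : ℕ → α → ℝ} {r₀ g : α → ℝ}
    (hr : ∀ n, Measurable (r n)) (hu : ∀ n, Measurable (u n))
    (hr₀ : MemLp r₀ 2 μ) (hg : MemLp g 2 μ) (hgr : ∀ x, r₀ x = 0 → g x = 0)
    (hrl : Tendsto (fun n => eLpNorm (r n - r₀) 2 μ) atTop (𝓝 0))
    (hfl : Tendsto (fun n => eLpNorm ((fun x => a n * u n x * r n x) - g) 2 μ) atTop (𝓝 0))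
    {F : ℝ → E} {A : E} {C : ℝ} (hF : StronglyMeasurable F) (hFC : ∀ w, ‖F w‖ ≤ C * w ^ 2)
    (hFA : (fun w : ℝ => F w - w ^ 2 • A) =o[𝓝 0] fun w => w ^ 2) :
    Tendsto (fun n => ∫ x, (a n * r n x) ^ 2 • F (u n x) ∂μ) atTop
      (𝓝 ((∫ x, g x ^ 2 ∂μ) • A)) := by
  -- The integrand becomes `f² ψ(u)` with `f = a u r`. The quotient `ψ` is bounded and continuous at
  -- `0`, which is all that is used.
  set ψ : ℝ → E := fun w => if w = 0 then A else (w ^ 2)⁻¹ • F w with hψ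
  have hψm : StronglyMeasurable ψ := by
    refine StronglyMeasurable.ite (measurableSet_singleton 0) stronglyMeasurable_const ?_
    exact ((measurable_id.pow_const 2).inv.stronglyMeasurable).smul hF
  have hFψ : ∀ w, F w = w ^ 2 • ψ w := by
    intro w
    by_cases hw : w = 0
    · have := hFC w
      simp only [hw, ne_eq, OfNat.ofNat_ne_zero, not_false_eq_true, zero_pow, mul_zero,
        norm_le_zero_iff] at this
      simp [hw, this]
    · simp [hψ, hw, smul_smul]
  have hψC : ∀ w, ‖ψ w‖ ≤ max C ‖A‖ := by
    intro w
    by_cases hw : w = 0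
    · simp [hψ, hw]
    · have h2 : 0 < w ^ 2 := by positivity
      simp only [hψ, hw, if_false, norm_smul, norm_inv, norm_pow, Real.norm_eq_abs, sq_abs]
      refine le_trans ?_ (le_max_left _ _)
      rw [inv_mul_le_iff₀ h2, mul_comm]
      exact hFC w
  have hψ0 : Tendsto ψ (𝓝 0) (𝓝 A) := by
    rw [Metric.tendsto_nhds]
    intro ε hε
    filter_upwards [hFA.def (half_pos hε)] with w hw
    rw [dist_eq_norm]
    by_cases h0 : w = 0
    · simpa [hψ, h0] using hε
    · have h2 : 0 < w ^ 2 := by positivity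
      have e : ψ w - A = (w ^ 2)⁻¹ • (F w - w ^ 2 • A) := by
        simp [hψ, h0, smul_sub, smul_smul]
      rw [e, norm_smul, norm_inv, norm_pow, Real.norm_eq_abs, sq_abs, inv_mul_lt_iff₀ h2]
      rw [norm_pow, Real.norm_eq_abs, sq_abs] at hw
      nlinarith
  set f : ℕ → α → ℝ := fun n x => a n * u n x * r n x with hf
  have hfm : ∀ n, Measurable (f n) := fun n => ((hu n).const_mul _).mul (hr n)
  have hψum : ∀ n, AEStronglyMeasurable (fun x => ψ (u n x)) μ := fun n =>
    (hψm.comp_measurable (hu n)).aestronglyMeasurable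
  have hfev : ∀ᶠ n in atTop, MemLp (f n) 2 μ :=
    eventually_memLp_of_tendsto (Eventually.of_forall fun n => (hfm n).aestronglyMeasurable) hg hfl
  have hg2 : Integrable (fun x => g x * g x) μ := hg.integrable_mul hg
  have hI : ∀ n, Integrable (fun x => (g x * g x) • ψ (u n x)) μ := fun n =>
    hg2.smul_bdd (max C ‖A‖) (hψum n) (Eventually.of_forall fun x => hψC _)
  -- Since `f² → g²` in `L¹` and `ψ` is bounded, `f²` may be replaced by the fixed weight `g²`.
  have h1 : Tendsto (fun n => ∫ x, (f n x * f n x - g x * g x) • ψ (u n x) ∂μ) atTop (𝓝 0) := by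
    have hl := tendsto_eLpNorm_mul_sub (Eventually.of_forall fun n =>
      (hfm n).aestronglyMeasurable) (Eventually.of_forall fun n =>
      (hfm n).aestronglyMeasurable) hg hg hfl hfl
    have hl' := ((ENNReal.tendsto_toReal ENNReal.zero_ne_top).comp hl).const_mul (max C ‖A‖)
    rw [ENNReal.toReal_zero, mul_zero] at hl'
    refine squeeze_zero_norm' ?_ hl'
    filter_upwards [hfev] with n hn
    have hint : Integrable ((fun x => f n x * f n x) - fun x => g x * g x) μ :=
      (hn.integrable_mul hn).sub hg2
    rw [Function.comp_apply, toReal_eLpNorm hint.1, lpNorm_one_eq_integral_norm hint.1,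
      ← integral_const_mul]
    refine norm_integral_le_of_norm_le (hint.norm.const_mul _) (Eventually.of_forall fun x => ?_)
    rw [norm_smul, mul_comm]
    exact mul_le_mul_of_nonneg_right (hψC _) (norm_nonneg _)
  have h2 : Tendsto (fun n => ∫ x, (g x * g x) • ψ (u n x) ∂μ) atTop
      (𝓝 (∫ x, (g x * g x) • A ∂μ)) := by
    -- Almost everywhere convergence of `u` is available only along subsequences and where `g ≠ 0`;
    -- the weight `g²` makes the rest irrelevant.
    refine tendsto_of_subseq_tendsto fun ks hks => ?_
    obtain ⟨ns, -, hns⟩ := exists_subseq_ae_tendsto_zero (ha.comp hks) (fun n => hr (ks n))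
      (fun n => hu (ks n)) hr₀ hg hgr (hrl.comp hks) (hfl.comp hks)
    refine ⟨ns, tendsto_integral_of_dominated_convergence
      (fun x => ‖g x * g x‖ * max C ‖A‖) (fun n => (hI _).1) (hg2.norm.mul_const _) ?_ ?_⟩
    · intro n
      refine Eventually.of_forall fun x => ?_
      rw [norm_smul]
      exact mul_le_mul_of_nonneg_left (hψC _) (norm_nonneg _)
    · filter_upwards [hns] with x hx
      by_cases hgx : g x = 0
      · simp [hgx]
      · exact (hψ0.comp (hx hgx)).const_smul _
  have h3 := h1.add h2
  rw [zero_add, integral_smul_const] at h3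
  simp only [pow_two (g _)]
  refine h3.congr' ?_
  filter_upwards [hfev] with n hn
  rw [← integral_add _ (hI n)]
  · refine integral_congr_ae (Eventually.of_forall fun x => ?_)
    simp only [hFψ (u n x), ← add_smul, smul_smul, hf]
    congr 1
    ring
  · exact ((hn.integrable_mul hn).sub hg2).smul_bdd (max C ‖A‖) (hψum n)
      (Eventually.of_forall fun x => hψC _)

end Core

/-! ### Densities, their roots and integrals under the law. -/

section Densities

variable {𝒳 : Type*} [MeasurableSpace 𝒳] {d : ℕ} {μ : Measure 𝒳}
  {Θ : Set (EuclideanSpace ℝ (Fin d))} {p : EuclideanSpace ℝ (Fin d) → 𝒳 → ℝ}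
  {θ : EuclideanSpace ℝ (Fin d)}

lemma IsDensityFamily.integrable (hp : IsDensityFamily μ Θ p) (hθ : θ ∈ Θ) :
    Integrable (p θ) μ := by
  refine ⟨(hp.measurable θ hθ).aestronglyMeasurable, ?_⟩
  rw [hasFiniteIntegral_iff_ofReal (Eventually.of_forall (hp.nonneg θ hθ)),
    hp.lintegral_eq_one θ hθ]
  exact ENNReal.one_lt_top

lemma IsDensityFamily.integral_eq_one (hp : IsDensityFamily μ Θ p) (hθ : θ ∈ Θ) :
    ∫ x, p θ x ∂μ = 1 := by
  rw [integral_eq_lintegral_of_nonneg_ae (Eventually.of_forall (hp.nonneg θ hθ))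
    (hp.measurable θ hθ).aestronglyMeasurable, hp.lintegral_eq_one θ hθ, ENNReal.toReal_one]

lemma IsDensityFamily.isProbabilityMeasure_law (hp : IsDensityFamily μ Θ p) (hθ : θ ∈ Θ) :
    IsProbabilityMeasure (law μ p θ) :=
  ⟨by rw [law, withDensity_apply _ MeasurableSet.univ, Measure.restrict_univ,
    hp.lintegral_eq_one θ hθ]⟩

lemma IsDensityFamily.measurable_sqrt (hp : IsDensityFamily μ Θ p) (hθ : θ ∈ Θ) :
    Measurable fun x => √(p θ x) :=
  (hp.measurable θ hθ).sqrt

lemma IsDensityFamily.memLp_sqrt (hp : IsDensityFamily μ Θ p) (hθ : θ ∈ Θ) :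
    MemLp (fun x => √(p θ x)) 2 μ := by
  rw [memLp_two_iff_integrable_sq (hp.measurable_sqrt hθ).aestronglyMeasurable]
  simpa only [Real.sq_sqrt (hp.nonneg θ hθ _)] using hp.integrable hθ

lemma IsDensityFamily.integral_law {E : Type*} [NormedAddCommGroup E] [NormedSpace ℝ E]
    (hp : IsDensityFamily μ Θ p) (hθ : θ ∈ Θ) (f : 𝒳 → E) :
    ∫ x, f x ∂(law μ p θ) = ∫ x, p θ x • f x ∂μ := by
  rw [law, integral_withDensity_eq_integral_toReal_smul (hp.measurable θ hθ).ennreal_ofReal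
    (Eventually.of_forall fun x => ENNReal.ofReal_lt_top)]
  simp only [ENNReal.toReal_ofReal (hp.nonneg θ hθ _)]

lemma IsDensityFamily.integrable_law_iff {E : Type*} [NormedAddCommGroup E] [NormedSpace ℝ E]
    (hp : IsDensityFamily μ Θ p) (hθ : θ ∈ Θ) {f : 𝒳 → E} :
    Integrable f (law μ p θ) ↔ Integrable (fun x => p θ x • f x) μ := by
  rw [law, integrable_withDensity_iff_integrable_smul' (hp.measurable θ hθ).ennreal_ofReal
    (Eventually.of_forall fun x => ENNReal.ofReal_lt_top)]
  simp only [ENNReal.toReal_ofReal (hp.nonneg θ hθ _)]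

lemma IsDensityFamily.memLp_law_iff (hp : IsDensityFamily μ Θ p) (hθ : θ ∈ Θ) {f : 𝒳 → ℝ}
    (hf : Measurable f) :
    MemLp f 2 (law μ p θ) ↔ MemLp (fun x => f x * √(p θ x)) 2 μ := by
  have hm : Measurable fun x => f x * √(p θ x) := hf.mul (hp.measurable_sqrt hθ)
  rw [memLp_two_iff_integrable_sq hf.aestronglyMeasurable,
    memLp_two_iff_integrable_sq hm.aestronglyMeasurable, hp.integrable_law_iff hθ]
  simp only [mul_pow, Real.sq_sqrt (hp.nonneg θ hθ _), smul_eq_mul, mul_comm]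

lemma IsDensityFamily.integral_law_sq (hp : IsDensityFamily μ Θ p) (hθ : θ ∈ Θ) (f : 𝒳 → ℝ) :
    ∫ x, f x ^ 2 ∂(law μ p θ) = ∫ x, (f x * √(p θ x)) ^ 2 ∂μ := by
  rw [hp.integral_law hθ]
  simp only [mul_pow, Real.sq_sqrt (hp.nonneg θ hθ _), smul_eq_mul, mul_comm]

end Densities

/-! ### Scores: integrability, mean zero, continuity in `L²`. -/

section Scores

variable {𝒳 : Type*} [MeasurableSpace 𝒳] {d : ℕ} {μ : Measure 𝒳}
  {Θ : Set (EuclideanSpace ℝ (Fin d))} {p : EuclideanSpace ℝ (Fin d) → 𝒳 → ℝ}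
  {s : 𝒳 → EuclideanSpace ℝ (Fin d)} {θ : EuclideanSpace ℝ (Fin d)}

lemma IsDensityFamily.measurable_rootRemainder (hp : IsDensityFamily μ Θ p) (hs : Measurable s)
    {θ₀ θ₁ : EuclideanSpace ℝ (Fin d)} (h₀ : θ₀ ∈ Θ) (h₁ : θ₁ ∈ Θ) :
    Measurable (rootRemainder p s θ₀ θ₁) := by
  have m0 := hp.measurable_sqrt h₀
  have m1 := hp.measurable_sqrt h₁
  have m2 : Measurable fun x => inner ℝ (θ₁ - θ₀) (s x) := measurable_const.inner hs
  exact (m1.sub m0).sub ((m2.const_mul _).mul m0)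

/-- Differentiability remainders stay negligible after rescaling by any `c` of order at most
`1/‖δ‖`. The bound on the product also allows `δ n = 0`. -/
lemma tendsto_eLpNorm_const_mul_of_isLittleO {V : Type*} [NormedAddCommGroup V]
    {R : ℕ → 𝒳 → ℝ} {δ : ℕ → V} {c : ℕ → ℝ} {B : ℝ}
    (hR : ∀ᶠ n in atTop, AEStronglyMeasurable (R n) μ)
    (hint : ∀ᶠ n in atTop, Integrable (fun x => R n x ^ 2) μ)
    (ho : (fun n => ∫ x, R n x ^ 2 ∂μ) =o[atTop] fun n => ‖δ n‖ ^ 2)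
    (hB : ∀ᶠ n in atTop, |c n| * ‖δ n‖ ≤ B) :
    Tendsto (fun n => eLpNorm (fun x => c n * R n x) 2 μ) atTop (𝓝 0) := by
  rw [tendsto_eLpNorm_two_iff_integral_sq]
  · have h1 : (fun n => c n ^ 2 * ∫ x, R n x ^ 2 ∂μ) =o[atTop] fun n => c n ^ 2 * ‖δ n‖ ^ 2 :=
      (isBigO_refl _ _).mul_isLittleO ho
    have h2 : (fun n => c n ^ 2 * ‖δ n‖ ^ 2) =O[atTop] fun _ => (1 : ℝ) := by
      refine IsBigO.of_bound (B ^ 2) ?_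
      filter_upwards [hB] with n hn
      rw [norm_one, mul_one, ← mul_pow, norm_pow, norm_mul, norm_norm, Real.norm_eq_abs]
      exact pow_le_pow_left₀ (by positivity) hn 2
    refine ((h1.trans_isBigO h2).tendsto_zero_of_tendsto tendsto_const_nhds |>.congr fun n => ?_)
    simp only [mul_pow, integral_const_mul]
  · filter_upwards [hR, hint] with n h1 h2
    exact ((memLp_two_iff_integrable_sq h1).2 h2).const_mul _

lemma tendsto_sum_mem_nhds {h : ℕ → EuclideanSpace ℝ (Fin d)} (hΘ : IsOpen Θ) (hθ : θ ∈ Θ)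
    (hh : Tendsto h atTop (𝓝 0)) : ∀ᶠ n in atTop, θ + h n ∈ Θ := by
  have : Tendsto (fun n => θ + h n) atTop (𝓝 θ) := by simpa using hh.const_add θ
  exact this.eventually_mem (hΘ.mem_nhds hθ)

lemma HasDQMScore.tendsto_eLpNorm (hp : IsDensityFamily μ Θ p) (hΘ : IsOpen Θ) (hθ : θ ∈ Θ)
    (hs : Measurable s) (hD : HasDQMScore μ p s θ) {h : ℕ → EuclideanSpace ℝ (Fin d)}
    (hh : Tendsto h atTop (𝓝 0)) {c : ℕ → ℝ} {B : ℝ} (hB : ∀ᶠ n in atTop, |c n| * ‖h n‖ ≤ B) :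
    Tendsto (fun n => eLpNorm (fun x => c n * rootRemainder p s θ (θ + h n) x) 2 μ) atTop
      (𝓝 0) := by
  refine tendsto_eLpNorm_const_mul_of_isLittleO ?_ (hh.eventually hD.1) (hD.2.comp_tendsto hh) hB
  filter_upwards [tendsto_sum_mem_nhds hΘ hθ hh] with n hn
  exact (hp.measurable_rootRemainder hs hθ hn).aestronglyMeasurable

/-- Square integrability of the score is not assumed: at one small step `k / (n + 1)` the remainder
and both roots are in `L²`, and the score term is a combination of them. -/
lemma HasDQMScore.memLp_inner (hp : IsDensityFamily μ Θ p) (hΘ : IsOpen Θ) (hθ : θ ∈ Θ)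
    (hs : Measurable s) (hD : HasDQMScore μ p s θ) (k : EuclideanSpace ℝ (Fin d)) :
    MemLp (fun x => inner ℝ k (s x) * √(p θ x)) 2 μ := by
  have hh : Tendsto (fun n : ℕ => (1 / ((n : ℝ) + 1)) • k) atTop (𝓝 0) := by
    simpa using (tendsto_one_div_add_atTop_nhds_zero_nat (𝕜 := ℝ)).smul_const k
  obtain ⟨n, h1, h2⟩ := ((hh.eventually hD.1).and (tendsto_sum_mem_nhds hΘ hθ hh)).exists
  have hR := (memLp_two_iff_integrable_sq
    (hp.measurable_rootRemainder hs hθ h2).aestronglyMeasurable).2 h1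
  have h3 := (((hp.memLp_sqrt h2).sub (hp.memLp_sqrt hθ)).sub hR).const_mul (2 * ((n : ℝ) + 1))
  refine h3.ae_eq (Eventually.of_forall fun x => ?_)
  have : (n : ℝ) + 1 ≠ 0 := by positivity
  simp only [Pi.sub_apply, rootRemainder, add_sub_cancel_left, real_inner_smul_left]
  field_simp
  ring

/-- A single `L²` function dominating all directions, needed when the direction varies with `n`. -/
lemma HasDQMScore.memLp_norm (hp : IsDensityFamily μ Θ p) (hΘ : IsOpen Θ) (hθ : θ ∈ Θ)
    (hs : Measurable s) (hD : HasDQMScore μ p s θ) :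
    MemLp (fun x => ‖s x‖ * √(p θ x)) 2 μ := by
  have h1 := memLp_finsetSum Finset.univ
    (fun i _ => (hD.memLp_inner hp hΘ hθ hs (EuclideanSpace.single i 1)).norm)
  refine h1.mono (hs.norm.mul (hp.measurable_sqrt hθ)).aestronglyMeasurable
    (Eventually.of_forall fun x => ?_)
  simp only [EuclideanSpace.inner_single_left, map_one, one_mul, norm_mul, norm_norm]
  rw [← Finset.sum_mul, norm_mul, norm_norm]
  refine mul_le_mul_of_nonneg_right ?_ (norm_nonneg _)
  rw [Real.norm_of_nonneg (Finset.sum_nonneg fun i _ => norm_nonneg _)]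
  conv_lhs => rw [← (EuclideanSpace.basisFun (Fin d) ℝ).sum_repr (s x)]
  refine (norm_sum_le _ _).trans (le_of_eq ?_)
  simp [norm_smul]

lemma HasDQMScore.tendsto_inner (hp : IsDensityFamily μ Θ p) (hΘ : IsOpen Θ) (hθ : θ ∈ Θ)
    (hs : Measurable s) (hD : HasDQMScore μ p s θ) {k : ℕ → EuclideanSpace ℝ (Fin d)}
    (hk : Tendsto k atTop (𝓝 0)) :
    Tendsto (fun n => eLpNorm (fun x => inner ℝ (k n) (s x) * √(p θ x)) 2 μ) atTop (𝓝 0) := by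
  have hN := hD.memLp_norm hp hΘ hθ hs
  have h1 : Tendsto (fun n => ENNReal.ofReal ‖k n‖ * eLpNorm (fun x => ‖s x‖ * √(p θ x)) 2 μ)
      atTop (𝓝 0) := by
    have h2 := ENNReal.tendsto_ofReal hk.norm
    simpa using ENNReal.Tendsto.mul_const h2 (Or.inr hN.2.ne)
  refine tendsto_of_tendsto_of_tendsto_of_le_of_le tendsto_const_nhds h1
    (fun _ => zero_le) fun n => ?_
  refine eLpNorm_le_mul_eLpNorm_of_ae_le_mul (Eventually.of_forall fun x => ?_) 2
  rw [norm_mul, norm_mul, norm_norm, ← mul_assoc]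
  exact mul_le_mul_of_nonneg_right (norm_inner_le_norm _ _) (norm_nonneg _)

lemma HasDQMScore.tendsto_sqrt (hp : IsDensityFamily μ Θ p) (hΘ : IsOpen Θ) (hθ : θ ∈ Θ)
    (hs : Measurable s) (hD : HasDQMScore μ p s θ) {h : ℕ → EuclideanSpace ℝ (Fin d)}
    (hh : Tendsto h atTop (𝓝 0)) :
    Tendsto (fun n => eLpNorm ((fun x => √(p (θ + h n) x)) - fun x => √(p θ x)) 2 μ) atTop
      (𝓝 0) := by
  have h1 := hD.tendsto_eLpNorm hp hΘ hθ hs hh (c := fun _ => 1) (B := 1) (by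
    have := hh.norm
    rw [norm_zero] at this
    filter_upwards [this.eventually_le_const one_pos] with n hn
    simpa using hn)
  have h2 := hD.tendsto_inner hp hΘ hθ hs
    (k := fun n => (1 / 2 : ℝ) • h n) (by simpa using hh.const_smul (1 / 2 : ℝ))
  have h3 := h1.add h2
  rw [zero_add] at h3
  refine tendsto_of_tendsto_of_tendsto_of_le_of_le' tendsto_const_nhds h3
    (Eventually.of_forall fun _ => zero_le) ?_
  filter_upwards [tendsto_sum_mem_nhds hΘ hθ hh] with n hn
  have e : ((fun x => √(p (θ + h n) x)) - fun x => √(p θ x)) =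
      (fun x => 1 * rootRemainder p s θ (θ + h n) x)
        + fun x => inner ℝ ((1 / 2 : ℝ) • h n) (s x) * √(p θ x) := by
    ext x
    simp only [Pi.sub_apply, Pi.add_apply, rootRemainder, add_sub_cancel_left,
      real_inner_smul_left]
    ring
  rw [e]
  exact eLpNorm_add_le
    ((hp.measurable_rootRemainder hs hθ hn).const_mul _).aestronglyMeasurable
    (hD.memLp_inner hp hΘ hθ hs _).1 (by simp)

/-- For unit vectors `u`, `v` of a Hilbert space, `⟨v - u, u⟩ = -½ ‖v - u‖²`. -/
lemma IsDensityFamily.integral_sqrt_sub_sq (hp : IsDensityFamily μ Θ p)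
    {θ₀ θ₁ : EuclideanSpace ℝ (Fin d)} (h₀ : θ₀ ∈ Θ) (h₁ : θ₁ ∈ Θ) :
    ∫ x, (√(p θ₁ x) - √(p θ₀ x)) * √(p θ₀ x) ∂μ
      = -(1 / 2) * ∫ x, (√(p θ₁ x) - √(p θ₀ x)) ^ 2 ∂μ := by
  have i1 : Integrable (fun x => √(p θ₁ x) * √(p θ₀ x)) μ :=
    (hp.memLp_sqrt h₁).integrable_mul (hp.memLp_sqrt h₀)
  have e1 : ∫ x, (√(p θ₁ x) - √(p θ₀ x)) * √(p θ₀ x) ∂μ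
      = (∫ x, √(p θ₁ x) * √(p θ₀ x) ∂μ) - 1 := by
    rw [← hp.integral_eq_one h₀, ← integral_sub i1 (hp.integrable h₀)]
    refine integral_congr_ae (Eventually.of_forall fun x => ?_)
    have := Real.sq_sqrt (hp.nonneg θ₀ h₀ x)
    simp only
    linear_combination -this
  have e2 : ∫ x, (√(p θ₁ x) - √(p θ₀ x)) ^ 2 ∂μ
      = 1 + 1 - 2 * ∫ x, √(p θ₁ x) * √(p θ₀ x) ∂μ := by
    nth_rewrite 1 [← hp.integral_eq_one h₁]
    rw [← hp.integral_eq_one h₀, ← integral_const_mul,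
      ← integral_add (hp.integrable h₁) (hp.integrable h₀),
      ← integral_sub (by exact (hp.integrable h₁).add (hp.integrable h₀)) (i1.const_mul 2)]
    refine integral_congr_ae (Eventually.of_forall fun x => ?_)
    have h0 := Real.sq_sqrt (hp.nonneg θ₀ h₀ x)
    have h1 := Real.sq_sqrt (hp.nonneg θ₁ h₁ x)
    simp only
    linear_combination h0 + h1
  rw [e1, e2]
  ring

/-- The score has mean zero. -/
lemma HasDQMScore.integral_inner_eq_zero (hp : IsDensityFamily μ Θ p) (hΘ : IsOpen Θ)
    (hθ : θ ∈ Θ) (hs : Measurable s) (hD : HasDQMScore μ p s θ) (k : EuclideanSpace ℝ (Fin d)) :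
    ∫ x, inner ℝ k (s x) ∂(law μ p θ) = 0 := by
  set t : ℕ → ℝ := fun n => 1 / ((n : ℝ) + 1) with ht
  have htp : ∀ n, 0 < t n := fun n => by positivity
  have ht0 : Tendsto t atTop (𝓝 0) := tendsto_one_div_add_atTop_nhds_zero_nat
  have hh : Tendsto (fun n : ℕ => t n • k) atTop (𝓝 0) := by simpa using ht0.smul_const k
  have hmem := tendsto_sum_mem_nhds hΘ hθ hh
  set v : 𝒳 → ℝ := fun x => inner ℝ k (s x) * √(p θ x) with hv
  have hvL : MemLp v 2 μ := hD.memLp_inner hp hΘ hθ hs k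
  set f : ℕ → 𝒳 → ℝ := fun n x => 2 * (t n)⁻¹ * (√(p (θ + t n • k) x) - √(p θ x)) with hf
  have hfm : ∀ᶠ n in atTop, AEStronglyMeasurable (f n) μ := by
    filter_upwards [hmem] with n hn
    exact (((hp.measurable_sqrt hn).sub (hp.measurable_sqrt hθ)).const_mul _).aestronglyMeasurable
  have hfl : Tendsto (fun n => eLpNorm (f n - v) 2 μ) atTop (𝓝 0) := by
    have h1 := hD.tendsto_eLpNorm hp hΘ hθ hs hh (c := fun n => 2 * (t n)⁻¹) (B := 2 * ‖k‖) (by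
      refine Eventually.of_forall fun n => le_of_eq ?_
      rw [norm_smul, Real.norm_of_nonneg (htp n).le, abs_of_pos (by have := htp n; positivity)]
      have := (htp n).ne'
      field_simp)
    refine h1.congr fun n => ?_
    congr 1
    ext x
    have := (htp n).ne'
    simp only [Pi.sub_apply, hf, hv, rootRemainder, add_sub_cancel_left, real_inner_smul_left]
    field_simp
  have hsq : MemLp (fun x => √(p θ x)) 2 μ := hp.memLp_sqrt hθ
  have l1 := tendsto_integral_mul_of_eLpNorm hfm (Eventually.of_forall fun _ => hsq.1) hvL hsq hfl
    (by simp : Tendsto (fun n : ℕ => eLpNorm ((fun x => √(p θ x)) - fun x => √(p θ x)) 2 μ) atTop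
      (𝓝 0))
  -- By the unit vector identity `∫ f √p = -(t/4) ∫ f²`. The right side vanishes in the limit
  -- because `∫ f²` converges; the left side tends to the mean of the score.
  have l2 := (tendsto_integral_mul_of_eLpNorm hfm hfm hvL hvL hfl hfl).mul
    (ht0.mul_const (-(1 / 4)))
  rw [zero_mul, mul_zero] at l2
  have l3 := tendsto_nhds_unique (l1.congr' ?_) l2
  · rw [hp.integral_law hθ, ← l3]
    refine integral_congr_ae (Eventually.of_forall fun x => ?_)
    have := Real.sq_sqrt (hp.nonneg θ hθ x)
    simp only [smul_eq_mul, hv]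
    linear_combination (-inner ℝ k (s x)) * this
  · filter_upwards [hmem] with n hn
    have e := hp.integral_sqrt_sub_sq hθ hn
    have := (htp n).ne'
    calc ∫ x, f n x * √(p θ x) ∂μ
        = 2 * (t n)⁻¹ * ∫ x, (√(p (θ + t n • k) x) - √(p θ x)) * √(p θ x) ∂μ := by
          rw [← integral_const_mul]; simp only [hf, mul_assoc]
      _ = (2 * (t n)⁻¹) ^ 2 * (∫ x, (√(p (θ + t n • k) x) - √(p θ x)) ^ 2 ∂μ)
            * (t n * (-(1 / 4))) := by rw [e]; field_simp; ring
      _ = (∫ x, f n x * f n x ∂μ) * (t n * (-(1 / 4))) := by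
          rw [← integral_const_mul]; simp only [hf, ← pow_two, mul_pow]

variable {score : EuclideanSpace ℝ (Fin d) → 𝒳 → EuclideanSpace ℝ (Fin d)}

lemma IsDDQM.tendsto_eLpNorm (hp : IsDensityFamily μ Θ p) (hΘ : IsOpen Θ) (hθ : θ ∈ Θ)
    (hs : ∀ θ' ∈ Θ, Measurable (score θ')) (hD : IsDDQM μ p score θ)
    {h h' : ℕ → EuclideanSpace ℝ (Fin d)} (hh : Tendsto h atTop (𝓝 0))
    (hh' : Tendsto h' atTop (𝓝 0)) {c : ℕ → ℝ} {B : ℝ}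
    (hB : ∀ᶠ n in atTop, |c n| * ‖h n - h' n‖ ≤ B) :
    Tendsto (fun n => eLpNorm (fun x => c n *
      rootRemainder p (score (θ + h' n)) (θ + h' n) (θ + h n) x) 2 μ) atTop (𝓝 0) := by
  obtain ⟨h1, h2⟩ := hD h h' hh hh'
  refine tendsto_eLpNorm_const_mul_of_isLittleO ?_ h1 h2 hB
  filter_upwards [tendsto_sum_mem_nhds hΘ hθ hh, tendsto_sum_mem_nhds hΘ hθ hh'] with n hn hn'
  exact (hp.measurable_rootRemainder (hs _ hn') hn' hn).aestronglyMeasurable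

/-- Double differentiability in quadratic mean makes the scores continuous in `L²`. -/
lemma IsDDQM.tendsto_score (hp : IsDensityFamily μ Θ p) (hΘ : IsOpen Θ) (hθ : θ ∈ Θ)
    (hs : ∀ θ' ∈ Θ, Measurable (score θ')) (hD : IsDDQM μ p score θ)
    (hDθ : HasDQMScore μ p (score θ) θ) {h' k : ℕ → EuclideanSpace ℝ (Fin d)}
    {k₀ : EuclideanSpace ℝ (Fin d)} (hh' : Tendsto h' atTop (𝓝 0))
    (hk : Tendsto k atTop (𝓝 k₀)) :
    Tendsto (fun n => eLpNorm
      ((fun x => inner ℝ (k n) (score (θ + h' n) x) * √(p (θ + h' n) x))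
        - fun x => inner ℝ k₀ (score θ x) * √(p θ x)) 2 μ) atTop (𝓝 0) := by
  -- A scale that dominates `‖h' n‖`, tends to `0`, and stays positive even when `h' n = 0`.
  set t : ℕ → ℝ := fun n => ‖h' n‖ + 1 / ((n : ℝ) + 1) with ht
  have htp : ∀ n, 0 < t n := fun n => by positivity
  have ht0 : Tendsto t atTop (𝓝 0) := by
    have h1 := hh'.norm.add (tendsto_one_div_add_atTop_nhds_zero_nat (𝕜 := ℝ))
    rwa [norm_zero, zero_add] at h1
  have hht : ∀ n, ‖h' n‖ ≤ t n := fun n => by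
    have : (0 : ℝ) ≤ 1 / ((n : ℝ) + 1) := by positivity
    simp only [ht]; linarith
  -- A third point, at distance of order `t` in direction `k n`. Expanding the root density around
  -- the triangle `θ`, `θ + h'`, `θ + h` makes the roots cancel and isolates the difference of the
  -- two scores; all three remainders are `o(t)`.
  set h : ℕ → EuclideanSpace ℝ (Fin d) := fun n => h' n + t n • k n with hhdef
  have hh : Tendsto h atTop (𝓝 0) := by simpa using hh'.add (ht0.smul hk)
  have hkb : ∀ᶠ n in atTop, ‖k n‖ ≤ ‖k₀‖ + 1 :=
    hk.norm.eventually_le_const (lt_add_one _)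
  have hc : ∀ n, |2 * (t n)⁻¹| = 2 * (t n)⁻¹ := fun n => by
    have := htp n
    exact abs_of_pos (by positivity)
  have A := hD.tendsto_eLpNorm hp hΘ hθ hs hh hh' (c := fun n => 2 * (t n)⁻¹)
    (B := 2 * (‖k₀‖ + 1)) (by
      filter_upwards [hkb] with n hn
      have := htp n
      rw [hc, hhdef, add_sub_cancel_left, norm_smul, Real.norm_of_nonneg (htp n).le]
      calc 2 * (t n)⁻¹ * (t n * ‖k n‖) = 2 * ‖k n‖ := by field_simp
        _ ≤ _ := by linarith)
  have B := hDθ.tendsto_eLpNorm hp hΘ hθ (hs θ hθ) hh (c := fun n => 2 * (t n)⁻¹)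
    (B := 2 * (‖k₀‖ + 1) + 2) (by
      filter_upwards [hkb] with n hn
      have := htp n
      rw [hc]
      calc 2 * (t n)⁻¹ * ‖h n‖ ≤ 2 * (t n)⁻¹ * (t n + t n * ‖k n‖) := by
            gcongr
            refine (norm_add_le _ _).trans (add_le_add (hht n) (le_of_eq ?_))
            rw [norm_smul, Real.norm_of_nonneg (htp n).le]
        _ = 2 * ‖k n‖ + 2 := by field_simp; ring
        _ ≤ _ := by linarith)
  have C := hDθ.tendsto_eLpNorm hp hΘ hθ (hs θ hθ) hh' (c := fun n => 2 * (t n)⁻¹)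
    (B := 2) (by
      refine Eventually.of_forall fun n => ?_
      have := htp n
      rw [hc]
      calc 2 * (t n)⁻¹ * ‖h' n‖ ≤ 2 * (t n)⁻¹ * t n := by
            gcongr
            exact hht n
        _ = 2 := by field_simp)
  have D := hDθ.tendsto_inner hp hΘ hθ (hs θ hθ) (k := fun n => k n - k₀)
    (by simpa using hk.sub_const k₀)
  have lim := ((B.add A).add C).add D
  simp only [add_zero] at lim
  refine tendsto_of_tendsto_of_tendsto_of_le_of_le' tendsto_const_nhds lim
    (Eventually.of_forall fun _ => zero_le) ?_
  filter_upwards [tendsto_sum_mem_nhds hΘ hθ hh, tendsto_sum_mem_nhds hΘ hθ hh'] with n hn hn'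
  have mA := ((hp.measurable_rootRemainder (hs _ hn') hn' hn).const_mul
    (2 * (t n)⁻¹)).aestronglyMeasurable (μ := μ)
  have mB := ((hp.measurable_rootRemainder (hs _ hθ) hθ hn).const_mul
    (2 * (t n)⁻¹)).aestronglyMeasurable (μ := μ)
  have mC := ((hp.measurable_rootRemainder (hs _ hθ) hθ hn').const_mul
    (2 * (t n)⁻¹)).aestronglyMeasurable (μ := μ)
  have mD := (hDθ.memLp_inner hp hΘ hθ (hs θ hθ) (k n - k₀)).1
  have e : ((fun x => inner ℝ (k n) (score (θ + h' n) x) * √(p (θ + h' n) x))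
        - fun x => inner ℝ k₀ (score θ x) * √(p θ x)) =
      (fun x => 2 * (t n)⁻¹ * rootRemainder p (score θ) θ (θ + h n) x)
      - (fun x => 2 * (t n)⁻¹ * rootRemainder p (score (θ + h' n)) (θ + h' n) (θ + h n) x)
      - (fun x => 2 * (t n)⁻¹ * rootRemainder p (score θ) θ (θ + h' n) x)
      + fun x => inner ℝ (k n - k₀) (score θ x) * √(p θ x) := by
    ext x
    have := (htp n).ne'
    have e1 : θ + h n - (θ + h' n) = t n • k n := by simp only [hhdef]; abel
    simp only [Pi.sub_apply, Pi.add_apply, rootRemainder, e1, add_sub_cancel_left,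
      real_inner_smul_left, inner_sub_left]
    simp only [hhdef, inner_add_left, real_inner_smul_left]
    field_simp
    ring
  rw [e]
  refine (eLpNorm_add_le ((mB.sub mA).sub mC) mD (by simp)).trans (add_le_add ?_ le_rfl)
  refine (eLpNorm_sub_le (mB.sub mA) mC (by simp)).trans (add_le_add ?_ le_rfl)
  exact eLpNorm_sub_le mB mA (by simp)

/-- The normalised increments of the root density converge in `L²`. -/
lemma IsDDQM.tendsto_sqrt_sub (hp : IsDensityFamily μ Θ p) (hΘ : IsOpen Θ) (hθ : θ ∈ Θ)
    (hs : ∀ θ' ∈ Θ, Measurable (score θ')) (hD : IsDDQM μ p score θ)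
    (hDθ : HasDQMScore μ p (score θ) θ) {h h' : ℕ → EuclideanSpace ℝ (Fin d)}
    {k : EuclideanSpace ℝ (Fin d)} (hh : Tendsto h atTop (𝓝 0)) (hh' : Tendsto h' atTop (𝓝 0))
    (hk : Tendsto (fun n : ℕ => √(n : ℝ) • (h n - h' n)) atTop (𝓝 k)) :
    Tendsto (fun n : ℕ => eLpNorm
      ((fun x => 2 * √(n : ℝ) * (√(p (θ + h n) x) - √(p (θ + h' n) x)))
        - fun x => inner ℝ k (score θ x) * √(p θ x)) 2 μ) atTop (𝓝 0) := by
  have A := hD.tendsto_eLpNorm hp hΘ hθ hs hh hh' (c := fun n => 2 * √(n : ℝ))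
    (B := 2 * (‖k‖ + 1)) (by
      filter_upwards [hk.norm.eventually_le_const (lt_add_one _)] with n hn
      rw [norm_smul, Real.norm_of_nonneg (Real.sqrt_nonneg _)] at hn
      rw [abs_of_nonneg (by positivity)]
      linarith)
  have lim := A.add (hD.tendsto_score hp hΘ hθ hs hDθ hh' hk)
  rw [zero_add] at lim
  refine tendsto_of_tendsto_of_tendsto_of_le_of_le' tendsto_const_nhds lim
    (Eventually.of_forall fun _ => zero_le) ?_
  filter_upwards [tendsto_sum_mem_nhds hΘ hθ hh, tendsto_sum_mem_nhds hΘ hθ hh'] with n hn hn'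
  have e : ((fun x => 2 * √(n : ℝ) * (√(p (θ + h n) x) - √(p (θ + h' n) x)))
        - fun x => inner ℝ k (score θ x) * √(p θ x)) =
      (fun x => 2 * √(n : ℝ) * rootRemainder p (score (θ + h' n)) (θ + h' n) (θ + h n) x)
      + ((fun x => inner ℝ (√(n : ℝ) • (h n - h' n)) (score (θ + h' n) x) * √(p (θ + h' n) x))
        - fun x => inner ℝ k (score θ x) * √(p θ x)) := by
    ext x
    have e1 : θ + h n - (θ + h' n) = h n - h' n := by abel
    simp only [Pi.sub_apply, Pi.add_apply, rootRemainder, e1, real_inner_smul_left]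
    ring
  rw [e]
  refine eLpNorm_add_le ((hp.measurable_rootRemainder (hs _ hn') hn' hn).const_mul
    _).aestronglyMeasurable (AEStronglyMeasurable.sub ?_
      (hDθ.memLp_inner hp hΘ hθ (hs θ hθ) k).1) (by simp)
  exact ((measurable_const.inner (hs _ hn')).mul (hp.measurable_sqrt hn')).aestronglyMeasurable

/-- `kᵀ I(θ) k` is the second moment of `kᵀ score`. -/
lemma HasDQMScore.quadForm_fisherInfo (hp : IsDensityFamily μ Θ p) (hΘ : IsOpen Θ) (hθ : θ ∈ Θ)
    (hs : Measurable (score θ)) (hD : HasDQMScore μ p (score θ) θ)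
    (k : EuclideanSpace ℝ (Fin d)) :
    quadForm (fisherInfo μ p score θ) k = ∫ x, (inner ℝ k (score θ x) * √(p θ x)) ^ 2 ∂μ := by
  -- Square integrable coordinates make every entry of the information matrix a convergent integral,
  -- so that sums and integrals may be interchanged.
  have hm : ∀ i, MemLp (fun x => score θ x i) 2 (law μ p θ) := by
    intro i
    have h1 := hD.memLp_inner hp hΘ hθ hs (EuclideanSpace.single i 1)
    simp only [EuclideanSpace.inner_single_left, map_one, one_mul] at h1
    refine (hp.memLp_law_iff hθ ?_).2 h1
    exact (EuclideanSpace.proj (𝕜 := ℝ) i).measurable.comp hs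
  rw [← hp.integral_law_sq hθ]
  have e : ∀ x, inner ℝ k (score θ x) ^ 2
      = ∑ i, ∑ j, k i * k j * (score θ x i * score θ x j) := by
    intro x
    rw [PiLp.inner_apply, pow_two, Finset.sum_mul_sum]
    refine Finset.sum_congr rfl fun i _ => Finset.sum_congr rfl fun j _ => ?_
    simp only [RCLike.inner_apply, conj_trivial]
    ring
  have hi : ∀ i j, Integrable (fun x => k i * k j * (score θ x i * score θ x j)) (law μ p θ) :=
    fun i j => ((hm i).integrable_mul (hm j)).const_mul _
  simp only [e]
  rw [integral_finsetSum _ fun i _ => integrable_finsetSum _ fun j _ => hi i j]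
  simp only [quadForm, dotProduct, Matrix.mulVec, fisherInfo, Matrix.of_apply, Finset.mul_sum]
  refine Finset.sum_congr rfl fun i _ => ?_
  rw [integral_finsetSum _ fun j _ => hi i j]
  refine Finset.sum_congr rfl fun j _ => ?_
  rw [integral_const_mul]
  ring

end Scores

/-! ### Taylor estimates for the truncated logarithm. -/

section TruncatedLog

/-- `2 log (1 + w / 2)`, the logarithm of the squared root ratio `(1 + w / 2)²`, truncated to `0`
outside `|w| ≤ 1`. -/
noncomputable def truncLog (w : ℝ) : ℝ := if |w| ≤ 1 then 2 * Real.log (1 + w / 2) else 0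

lemma measurable_truncLog : Measurable truncLog := by
  refine Measurable.ite (measurableSet_le measurable_id.abs measurable_const) ?_ measurable_const
  exact ((measurable_id.div_const 2).const_add 1).log.const_mul 2

lemma abs_truncLog_sub_le_sq (w : ℝ) : |truncLog w - w| ≤ w ^ 2 := by
  by_cases hw : |w| ≤ 1
  · have h1 : |-(w / 2)| = |w| / 2 := by rw [abs_neg, abs_div, abs_two]
    have h := Real.abs_log_sub_add_sum_range_le (x := -(w / 2)) (by rw [h1]; linarith) 1
    simp only [Finset.sum_range_one, sub_neg_eq_add, h1] at h
    have e : truncLog w - w = 2 * ((-(w / 2)) ^ (0 + 1) / ((0 : ℕ) + 1) + Real.log (1 + w / 2)) := by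
      simp only [truncLog, hw, if_true]; push_cast; ring
    rw [e, abs_mul, abs_two]
    have h2 : (|w| / 2) ^ (1 + 1) / (1 - |w| / 2) ≤ w ^ 2 / 2 := by
      rw [div_le_iff₀ (by linarith)]
      have := sq_abs w
      have h3 : 0 ≤ w ^ 2 * (1 - |w|) := mul_nonneg (sq_nonneg _) (by linarith)
      rw [show (|w| / 2) ^ (1 + 1) = |w| ^ 2 / 4 by ring, this]
      linarith
    linarith
  · simp only [truncLog, hw, if_false, zero_sub, abs_neg]
    rw [← sq_abs]
    nlinarith

lemma abs_truncLog_sub_le (w : ℝ) : |truncLog w - w| ≤ |w| := by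
  by_cases hw : |w| ≤ 1
  · refine (abs_truncLog_sub_le_sq w).trans ?_
    rw [← sq_abs]
    nlinarith [abs_nonneg w]
  · simp [truncLog, hw]

lemma abs_truncLog_le (w : ℝ) : |truncLog w| ≤ 2 * |w| := by
  have := abs_truncLog_sub_le w
  have h2 := abs_add_le (truncLog w - w) w
  rw [sub_add_cancel] at h2
  linarith

lemma eventually_abs_le_one : ∀ᶠ w : ℝ in 𝓝 0, |w| ≤ 1 := by
  have : Tendsto (fun w : ℝ => |w|) (𝓝 0) (𝓝 0) := by
    simpa using (continuous_abs.tendsto (0 : ℝ))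
  exact this.eventually_le_const one_pos

/-- Second order expansion `2 log (1 + w/2) = w - w²/4 + O(w³)`; the truncation is invisible near
`0`. -/
lemma truncLog_isLittleO :
    (fun w : ℝ => truncLog w - w - w ^ 2 • (-(1 / 4) : ℝ)) =o[𝓝 0] fun w => w ^ 2 := by
  have h3 : (fun w : ℝ => w ^ 3) =o[𝓝 0] fun w => w ^ 2 := by
    exact isLittleO_pow_pow (by norm_num)
  refine IsBigO.trans_isLittleO (IsBigO.of_bound 1 ?_) h3
  filter_upwards [eventually_abs_le_one] with w hw
  have h1 : |-(w / 2)| = |w| / 2 := by rw [abs_neg, abs_div, abs_two]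
  have h := Real.abs_log_sub_add_sum_range_le (x := -(w / 2)) (by rw [h1]; linarith) 2
  simp only [Finset.sum_range_succ, Finset.sum_range_zero, sub_neg_eq_add, h1] at h
  have e : truncLog w - w - w ^ 2 • (-(1 / 4) : ℝ) = 2 * (0 + (-(w / 2)) ^ (0 + 1) / ((0 : ℕ) + 1)
      + (-(w / 2)) ^ (1 + 1) / ((1 : ℕ) + 1) + Real.log (1 + w / 2)) := by
    simp only [truncLog, hw, if_true, smul_eq_mul]; push_cast; ring
  rw [e, norm_mul, Real.norm_eq_abs, abs_two, one_mul, Real.norm_eq_abs, Real.norm_eq_abs, abs_pow]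
  have h2 : (|w| / 2) ^ (2 + 1) / (1 - |w| / 2) ≤ |w| ^ 3 / 2 := by
    rw [div_le_iff₀ (by linarith)]
    have h4 : 0 ≤ |w| ^ 3 * (1 - |w|) := mul_nonneg (by positivity) (by linarith)
    have h5 : 0 ≤ |w| ^ 3 := by positivity
    rw [show (|w| / 2) ^ (2 + 1) = |w| ^ 3 / 8 by ring]
    linarith
  linarith

/-- Taylor's bound for `|u| ≤ 1`; otherwise the triangle inequality gives `2|u| ≤ 2u²`. -/
lemma norm_exp_mul_I_sub_le (u : ℝ) :
    ‖Complex.exp (u * Complex.I) - 1 - u * Complex.I‖ ≤ 2 * u ^ 2 := by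
  by_cases hu : |u| ≤ 1
  · have h := Complex.norm_exp_sub_one_sub_id_le (x := u * Complex.I) (by simpa using hu)
    simp only [norm_mul, Complex.norm_real, Complex.norm_I, mul_one, Real.norm_eq_abs, sq_abs] at h
    nlinarith [sq_nonneg u]
  · have h1 : ‖Complex.exp (u * Complex.I) - 1‖ ≤ |u| := by
      have := Real.norm_exp_I_mul_ofReal_sub_one_le (x := u)
      rwa [mul_comm] at this
    have h2 := norm_sub_le (Complex.exp (u * Complex.I) - 1) (u * Complex.I)
    simp only [norm_mul, Complex.norm_real, Complex.norm_I, mul_one, Real.norm_eq_abs] at h2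
    rw [← sq_abs u]
    nlinarith

lemma exp_mul_I_isLittleO :
    (fun u : ℝ => Complex.exp (u * Complex.I) - 1 - u * Complex.I + (u : ℂ) ^ 2 / 2)
      =o[𝓝 0] fun u => u ^ 2 := by
  have h3 : (fun w : ℝ => w ^ 3) =o[𝓝 0] fun w => w ^ 2 := isLittleO_pow_pow (by norm_num)
  refine IsBigO.trans_isLittleO ?_ h3
  have hl : Tendsto (fun u : ℝ => (u : ℂ) * Complex.I) (𝓝 0) (𝓝 0) := by
    have : Continuous fun u : ℝ => (u : ℂ) * Complex.I := by fun_prop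
    simpa using this.tendsto 0
  have h := (Complex.exp_sub_sum_range_isBigO_pow 3).comp_tendsto hl
  refine (h.congr_left fun u => ?_).trans (IsBigO.of_bound 1 (Eventually.of_forall fun u => ?_))
  · simp only [Function.comp_apply, Finset.sum_range_succ, Finset.sum_range_zero]
    simp only [mul_pow, Complex.I_sq, Nat.factorial]
    push_cast
    ring
  · simp

/-- With `T` the truncated logarithm, `8 t²` is `2 (tT)²` under `|T| ≤ 2|w|`, and `|t|` comes from
replacing `T` by `w` in the linear term. -/
lemma norm_exp_truncLog_sub_le (t w : ℝ) :
    ‖Complex.exp (t * truncLog w * Complex.I) - 1 - t * w * Complex.I‖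
      ≤ (8 * t ^ 2 + |t|) * w ^ 2 := by
  have h1 := norm_exp_mul_I_sub_le (t * truncLog w)
  push_cast at h1
  have e : Complex.exp (t * truncLog w * Complex.I) - 1 - t * w * Complex.I
      = (Complex.exp (t * truncLog w * Complex.I) - 1 - t * truncLog w * Complex.I)
        + ((t * (truncLog w - w) : ℝ) : ℂ) * Complex.I := by push_cast; ring
  rw [e]
  refine (norm_add_le _ _).trans ?_
  rw [norm_mul (_ : ℂ) Complex.I, Complex.norm_real, Complex.norm_I, mul_one, Real.norm_eq_abs,
    abs_mul]
  have h2 := mul_le_mul_of_nonneg_left (abs_truncLog_sub_le_sq w) (abs_nonneg t)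
  have h3 := pow_le_pow_left₀ (abs_nonneg _) (abs_truncLog_le w) 2
  rw [sq_abs, mul_pow, sq_abs] at h3
  have h4 := mul_le_mul_of_nonneg_left h3 (sq_nonneg t)
  nlinarith

lemma truncLog_isBigO : truncLog =O[𝓝 0] fun w => w :=
  IsBigO.of_bound 2 (Eventually.of_forall fun w => abs_truncLog_le w)

lemma exp_truncLog_isLittleO (t : ℝ) :
    (fun w : ℝ => (Complex.exp (t * truncLog w * Complex.I) - 1 - t * w * Complex.I)
      - w ^ 2 • (-(t ^ 2 / 2 : ℂ) - t / 4 * Complex.I)) =o[𝓝 0] fun w => w ^ 2 := by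
  have ht0 : Tendsto (fun w => t * truncLog w) (𝓝 0) (𝓝 0) := by
    simpa using (truncLog_isBigO.trans_tendsto tendsto_id).const_mul t
  have h1 : (fun w : ℝ => Complex.exp (t * truncLog w * Complex.I) - 1
      - t * truncLog w * Complex.I + (t * truncLog w : ℂ) ^ 2 / 2) =o[𝓝 0] fun w => w ^ 2 := by
    have h := exp_mul_I_isLittleO.comp_tendsto ht0
    refine IsLittleO.trans_isBigO (h.congr_left fun w => ?_) ((truncLog_isBigO.const_mul_left t).pow 2)
    simp only [Function.comp_apply]
    push_cast
    ring
  have h2 : (fun w : ℝ => ((truncLog w - w - w ^ 2 • (-(1 / 4) : ℝ) : ℝ) : ℂ)) =o[𝓝 0]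
      fun w => w ^ 2 := by
    rw [← isLittleO_norm_left]
    simpa only [Complex.norm_real, isLittleO_norm_left] using truncLog_isLittleO
  have h3 : (fun w : ℝ => (((truncLog w - w) * (truncLog w + w) : ℝ) : ℂ)) =o[𝓝 0]
      fun w => w ^ 2 := by
    rw [← isLittleO_norm_left]
    simp only [Complex.norm_real, isLittleO_norm_left]
    have hb : (fun w => truncLog w - w) =O[𝓝 0] fun w => w ^ 2 :=
      IsBigO.of_bound 1 (Eventually.of_forall fun w => by
        simpa using abs_truncLog_sub_le_sq w)
    have hc : (fun w => truncLog w + w) =O[𝓝 0] fun w => w :=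
      truncLog_isBigO.add (isBigO_refl _ _)
    have hbc := hb.mul hc
    refine hbc.trans_isLittleO ?_
    simp only [← pow_succ]
    exact isLittleO_pow_pow (by norm_num)
  -- The quadratic coefficient collects `-t²/2` from the exponential, with `T²` replaced by `w²`
  -- through `h3`, and `-it/4` from the logarithm through `h2`.
  have h4 := (h1.add (h2.const_mul_left (t * Complex.I))).sub
    (h3.const_mul_left (t ^ 2 / 2 : ℂ))
  refine h4.congr_left fun w => ?_
  simp only [smul_eq_mul, Complex.real_smul]
  push_cast
  ring

end TruncatedLog

/-! ### Limit theorems for iid rows. -/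

section TriangularArrays

variable {𝒳 : Type*} [MeasurableSpace 𝒳] {Ω : ℕ → Type*} [∀ n, MeasurableSpace (Ω n)]
  {P : ∀ n, Measure (Ω n)} {X : ∀ n, Fin n → Ω n → 𝒳}
  {Q : ℕ → Measure 𝒳}

lemma tendsto_measure_exists_mem [∀ n, IsProbabilityMeasure (Q n)]
    (hX : ∀ n i, HasLaw (X n i) (Q n) (P n)) {B : ℕ → Set 𝒳} (hB : ∀ n, MeasurableSet (B n))
    (hlim : Tendsto (fun n : ℕ => n * (Q n).real (B n)) atTop (𝓝 0)) :
    Tendsto (fun n => P n {ω | ∃ i, X n i ω ∈ B n}) atTop (𝓝 0) := by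
  have h1 := ENNReal.tendsto_ofReal hlim
  rw [ENNReal.ofReal_zero] at h1
  refine tendsto_of_tendsto_of_tendsto_of_le_of_le tendsto_const_nhds h1 (fun _ => zero_le)
    fun n => ?_
  have e : {ω | ∃ i, X n i ω ∈ B n} = ⋃ i, X n i ⁻¹' B n := by ext; simp
  have e2 : ∀ i, P n (X n i ⁻¹' B n) = Q n (B n) := fun i => by
    rw [← (hX n i).map_eq, Measure.map_apply_of_aemeasurable (hX n i).aemeasurable (hB n)]
  simp only [e]
  refine (measure_iUnion_fintype_le _ _).trans (le_of_eq ?_)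
  simp only [e2, Finset.sum_const, Finset.card_univ, Fintype.card_fin, nsmul_eq_mul]
  rw [ENNReal.ofReal_mul (by positivity), ENNReal.ofReal_natCast, ofReal_measureReal]

/-- A weak law of large numbers for triangular arrays of iid rows. -/
lemma isLittleOInProb_sum_sub [∀ n, IsProbabilityMeasure (P n)]
    (hindep : ∀ n, iIndepFun (X n) (P n)) (hX : ∀ n i, HasLaw (X n i) (Q n) (P n))
    {Z : ℕ → 𝒳 → ℝ} {m : ℝ} (hZ : ∀ n, Measurable (Z n)) (hZ2 : ∀ᶠ n in atTop, MemLp (Z n) 2 (Q n))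
    (hm : Tendsto (fun n : ℕ => n * ∫ x, Z n x ∂(Q n)) atTop (𝓝 m))
    (hv : Tendsto (fun n : ℕ => n * ∫ x, Z n x ^ 2 ∂(Q n)) atTop (𝓝 0)) :
    IsLittleOInProb P fun n ω => ∑ i, Z n (X n i ω) - m := by
  intro ε hε
  have hlim : Tendsto (fun n : ℕ => ENNReal.ofReal ((n * ∫ x, Z n x ^ 2 ∂(Q n)) / (ε / 2) ^ 2))
      atTop (𝓝 0) := by
    simpa using ENNReal.tendsto_ofReal (hv.div_const ((ε / 2) ^ 2))
  refine tendsto_of_tendsto_of_tendsto_of_le_of_le' tendsto_const_nhds hlim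
    (Eventually.of_forall fun _ => zero_le) ?_
  -- Half of `ε` absorbs the error in the mean, the other half goes to Chebyshev's inequality.
  filter_upwards [hZ2, (Metric.tendsto_nhds.1 hm) (ε / 2) (half_pos hε)] with n hn hd
  have hlaw : ∀ i, MemLp (fun ω => Z n (X n i ω)) 2 (P n) := fun i => by
    refine MemLp.comp_of_map ?_ (hX n i).aemeasurable
    rwa [(hX n i).map_eq]
  have hmean : ∀ i, ∫ ω, Z n (X n i ω) ∂(P n) = ∫ x, Z n x ∂(Q n) := fun i =>
    (hX n i).integral_comp (hZ n).aestronglyMeasurable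
  have hvar : ∀ i, Var[fun ω => Z n (X n i ω); P n] ≤ ∫ x, Z n x ^ 2 ∂(Q n) := fun i => by
    refine (variance_le_expectation_sq (hlaw i).1).trans (le_of_eq ?_)
    exact (hX n i).integral_comp (f := fun x => Z n x ^ 2)
      ((hZ n).pow_const 2).aestronglyMeasurable
  set Y : Ω n → ℝ := ∑ i, fun ω => Z n (X n i ω) with hY
  have hYapp : ∀ ω, Y ω = ∑ i, Z n (X n i ω) := fun ω => by simp [hY]
  have hYL : MemLp Y 2 (P n) := memLp_finsetSum' _ fun i _ => hlaw i
  have hYm : ∫ ω, Y ω ∂(P n) = n * ∫ x, Z n x ∂(Q n) := by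
    simp only [hYapp]
    rw [integral_finsetSum _ fun i _ => (hlaw i).integrable (by simp)]
    simp [hmean]
  have hYv : Var[Y; P n] ≤ n * ∫ x, Z n x ^ 2 ∂(Q n) := by
    rw [hY, IndepFun.variance_sum (fun i _ => hlaw i)]
    · refine (Finset.sum_le_sum fun i _ => hvar i).trans (le_of_eq ?_)
      simp
    · intro i _ j _ hij
      exact ((hindep n).indepFun hij).comp (hZ n) (hZ n)
  refine le_trans (measure_mono ?_) ((meas_ge_le_variance_div_sq hYL (half_pos hε)).trans
    (ENNReal.ofReal_le_ofReal (div_le_div_of_nonneg_right hYv (by positivity))))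
  intro ω hω
  simp only [Set.mem_ofPred_eq] at hω ⊢
  rw [hYm, hYapp]
  rw [Real.dist_eq] at hd
  have h3 := abs_sub_le (∑ i, Z n (X n i ω)) (n * ∫ x, Z n x ∂(Q n)) m
  linarith

/-- The characteristic functions of the row sums of a triangular array of iid rows. -/
lemma tendsto_charFun_sum [∀ n, IsProbabilityMeasure (P n)] [∀ n, IsProbabilityMeasure (Q n)]
    (hindep : ∀ n, iIndepFun (X n) (P n)) (hX : ∀ n i, HasLaw (X n i) (Q n) (P n))
    {τ : ℕ → 𝒳 → ℝ} (hτ : ∀ n, Measurable (τ n)) {t : ℝ} {z : ℂ}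
    (hz : Tendsto (fun n : ℕ => n * ∫ x, (Complex.exp (t * τ n x * Complex.I) - 1) ∂(Q n)) atTop
      (𝓝 z)) :
    Tendsto (fun n => charFun ((P n).map fun ω => ∑ i, τ n (X n i ω)) t) atTop
      (𝓝 (Complex.exp z)) := by
  -- The characteristic function of the sum is `(1 + c n) ^ n` with `n * c n → z`.
  refine (Complex.tendsto_one_add_pow_exp_of_tendsto hz).congr fun n => ?_
  have hm : ∀ i, AEMeasurable (fun ω => τ n (X n i ω)) (P n) := fun i =>
    (hτ n).comp_aemeasurable (hX n i).aemeasurable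
  have hind : iIndepFun (fun i ω => τ n (X n i ω)) (P n) :=
    (hindep n).comp (fun _ => τ n) fun _ => hτ n
  have hme : Measurable fun x => Complex.exp (t * τ n x * Complex.I) := by
    have := hτ n
    fun_prop
  have hi : Integrable (fun x => Complex.exp (t * τ n x * Complex.I)) (Q n) := by
    refine Integrable.of_bound hme.aestronglyMeasurable 1 (Eventually.of_forall fun x => ?_)
    rw [← Complex.ofReal_mul, Complex.norm_exp_ofReal_mul_I]
  have hc : ∀ i, charFun ((P n).map fun ω => τ n (X n i ω)) t
      = 1 + ∫ x, (Complex.exp (t * τ n x * Complex.I) - 1) ∂(Q n) := by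
    intro i
    have hint := (hX n i).integral_comp hme.aestronglyMeasurable
    simp only [Function.comp_def] at hint
    rw [charFun_apply_real, integral_map (hm i) (by fun_prop), hint,
      integral_sub hi (integrable_const _)]
    simp
  rw [hind.charFun_map_fun_sum_eq_prod hm, Finset.prod_apply]
  simp [hc]

lemma norm_charFun_map_sub_le {Ω' : Type*} [MeasurableSpace Ω'] {P' : Measure Ω'}
    [IsProbabilityMeasure P'] {Y Z : Ω' → ℝ} (hY : AEMeasurable Y P') (hZ : AEMeasurable Z P')
    {D : Set Ω'} (hD : ∀ ω ∉ D, Y ω = Z ω) (t : ℝ) :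
    ‖charFun (P'.map Y) t - charFun (P'.map Z) t‖ ≤ 2 * P'.real D := by
  have hn : ∀ y : ℝ, ‖Complex.exp (t * y * Complex.I)‖ = 1 := fun y => by
    rw [← Complex.ofReal_mul, Complex.norm_exp_ofReal_mul_I]
  have hi : ∀ {V : Ω' → ℝ}, AEMeasurable V P' →
      Integrable (fun ω => Complex.exp (t * V ω * Complex.I)) P' := fun {V} hV =>
    Integrable.of_bound (by fun_prop) 1 (Eventually.of_forall fun ω => (hn _).le)
  rw [charFun_apply_real, charFun_apply_real, integral_map hY (by fun_prop),
    integral_map hZ (by fun_prop), ← integral_sub (hi hY) (hi hZ)]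
  -- `D` need not be measurable, so its measurable hull, of the same measure, carries the bound.
  set S := toMeasurable P' D
  have hS : MeasurableSet S := measurableSet_toMeasurable _ _
  have hDS : P'.real S = P'.real D := by simp [S, Measure.real, measure_toMeasurable]
  refine (norm_integral_le_of_norm_le (g := S.indicator fun _ => (2 : ℝ))
    ((integrable_const 2).indicator hS) (Eventually.of_forall fun ω => ?_)).trans (le_of_eq ?_)
  · by_cases hω : ω ∈ S
    · rw [Set.indicator_of_mem hω]
      refine (norm_sub_le _ _).trans ?_
      rw [hn, hn]
      norm_num
    · rw [Set.indicator_of_notMem hω, hD ω fun h => hω (subset_toMeasurable _ _ h)]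
      simp
  · rw [integral_indicator_const _ hS, hDS, smul_eq_mul, mul_comm]

lemma IsLittleOInProb.congr_of_tendsto {R R' : ∀ n, Ω n → ℝ} (hR : IsLittleOInProb P R)
    {D : ∀ n, Set (Ω n)} (hD : Tendsto (fun n => P n (D n)) atTop (𝓝 0))
    (hRR' : ∀ n, ∀ ω ∉ D n, R' n ω = R n ω) : IsLittleOInProb P R' := by
  intro ε hε
  have hlim := (hR ε hε).add hD
  rw [zero_add] at hlim
  refine tendsto_of_tendsto_of_tendsto_of_le_of_le tendsto_const_nhds hlim (fun _ => zero_le)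
    fun n => (measure_mono fun ω hω => ?_).trans (measure_union_le _ _)
  by_cases hωD : ω ∈ D n
  · exact Or.inr hωD
  · left
    change ε ≤ |R n ω|
    rw [← hRR' n ω hωD]
    exact hω

end TriangularArrays

/-! ### Relative increments of the root density. -/

section RootIncrements

variable {𝒳 : Type*} {d : ℕ} {p : EuclideanSpace ℝ (Fin d) → 𝒳 → ℝ}

/-- The relative increment `2 (√(p_{θ₁} / p_{θ₀}) - 1)` of the root density
(equal to `-2` where `p_{θ₀} = 0`). -/
noncomputable def rootIncrement (p : EuclideanSpace ℝ (Fin d) → 𝒳 → ℝ)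
    (θ₀ θ₁ : EuclideanSpace ℝ (Fin d)) (x : 𝒳) : ℝ :=
  2 * (√(p θ₁ x) / √(p θ₀ x) - 1)

variable {θ₀ θ₁ : EuclideanSpace ℝ (Fin d)}

lemma rootIncrement_mul_sqrt_of_eq_zero {x : 𝒳} (hx : √(p θ₀ x) = 0) :
    rootIncrement p θ₀ θ₁ x * √(p θ₀ x) = 0 := by
  rw [hx, mul_zero]

lemma rootIncrement_mul_sqrt_of_ne_zero {x : 𝒳} (hx : √(p θ₀ x) ≠ 0) :
    rootIncrement p θ₀ θ₁ x * √(p θ₀ x) = 2 * (√(p θ₁ x) - √(p θ₀ x)) := by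
  rw [rootIncrement]
  field_simp

/-- If either density vanishes, division by zero included, the increment is `-2`. The threshold `1`
thus excludes the points where a logarithm would be meaningless. -/
lemma pos_of_abs_rootIncrement_le_one {x : 𝒳} (hx : |rootIncrement p θ₀ θ₁ x| ≤ 1) :
    0 < p θ₀ x ∧ 0 < p θ₁ x := by
  have h0 : √(p θ₀ x) ≠ 0 := fun h => by
    rw [rootIncrement, h, div_zero] at hx
    norm_num at hx
  have h1 : √(p θ₁ x) ≠ 0 := fun h => by
    rw [rootIncrement, h, zero_div] at hx
    norm_num at hx
  exact ⟨Real.sqrt_ne_zero'.1 h0, Real.sqrt_ne_zero'.1 h1⟩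

lemma truncLog_rootIncrement {x : 𝒳} (hx : |rootIncrement p θ₀ θ₁ x| ≤ 1) :
    truncLog (rootIncrement p θ₀ θ₁ x) = Real.log (p θ₁ x) - Real.log (p θ₀ x) := by
  obtain ⟨h0, h1⟩ := pos_of_abs_rootIncrement_le_one hx
  rw [truncLog, if_pos hx, rootIncrement]
  have e : 1 + 2 * (√(p θ₁ x) / √(p θ₀ x) - 1) / 2 = √(p θ₁ x) / √(p θ₀ x) := by ring
  rw [e, Real.log_div (Real.sqrt_ne_zero'.2 h1) (Real.sqrt_ne_zero'.2 h0), Real.log_sqrt h0.le,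
    Real.log_sqrt h1.le]
  ring

variable [MeasurableSpace 𝒳] {μ : Measure 𝒳} {Θ : Set (EuclideanSpace ℝ (Fin d))}

lemma IsDensityFamily.measurable_rootIncrement (hp : IsDensityFamily μ Θ p) (h₀ : θ₀ ∈ Θ)
    (h₁ : θ₁ ∈ Θ) : Measurable (rootIncrement p θ₀ θ₁) :=
  (((hp.measurable_sqrt h₁).div (hp.measurable_sqrt h₀)).sub_const 1).const_mul 2

lemma IsDensityFamily.memLp_rootIncrement (hp : IsDensityFamily μ Θ p) (h₀ : θ₀ ∈ Θ)
    (h₁ : θ₁ ∈ Θ) : MemLp (rootIncrement p θ₀ θ₁) 2 (law μ p θ₀) := by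
  have hm := hp.measurable_rootIncrement h₀ h₁
  rw [hp.memLp_law_iff h₀ hm]
  refine (((hp.memLp_sqrt h₁).sub (hp.memLp_sqrt h₀)).const_mul 2).mono
    (hm.mul (hp.measurable_sqrt h₀)).aestronglyMeasurable (Eventually.of_forall fun x => ?_)
  by_cases hx : √(p θ₀ x) = 0
  · rw [rootIncrement_mul_sqrt_of_eq_zero hx, norm_zero]
    exact norm_nonneg _
  · rw [rootIncrement_mul_sqrt_of_ne_zero hx, Pi.sub_apply]

/-- This is exact even if part of the mass of `p θ₁` lies on `{p θ₀ = 0}`, because the unit vector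
identity already accounts for that mass. -/
lemma IsDensityFamily.integral_rootIncrement (hp : IsDensityFamily μ Θ p) (h₀ : θ₀ ∈ Θ)
    (h₁ : θ₁ ∈ Θ) :
    ∫ x, rootIncrement p θ₀ θ₁ x ∂(law μ p θ₀) = -∫ x, (√(p θ₁ x) - √(p θ₀ x)) ^ 2 ∂μ := by
  have h := hp.integral_sqrt_sub_sq h₀ h₁
  have e : ∫ x, rootIncrement p θ₀ θ₁ x ∂(law μ p θ₀)
      = 2 * ∫ x, (√(p θ₁ x) - √(p θ₀ x)) * √(p θ₀ x) ∂μ := by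
    rw [hp.integral_law h₀, ← integral_const_mul]
    refine integral_congr_ae (Eventually.of_forall fun x => ?_)
    have hsq := Real.sq_sqrt (hp.nonneg θ₀ h₀ x)
    simp only [smul_eq_mul]
    by_cases hx : √(p θ₀ x) = 0
    · rw [← hsq, hx]
      ring
    · have := rootIncrement_mul_sqrt_of_ne_zero (p := p) (θ₁ := θ₁) hx
      linear_combination (-rootIncrement p θ₀ θ₁ x) * hsq + √(p θ₀ x) * this
  rw [e, h]
  ring

end RootIncrements

/-! ### Limits of the increments in `L²` and of their moments. -/

section Limits

variable {𝒳 : Type*} [MeasurableSpace 𝒳] {d : ℕ} {μ : Measure 𝒳}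
  {Θ : Set (EuclideanSpace ℝ (Fin d))} {p : EuclideanSpace ℝ (Fin d) → 𝒳 → ℝ}
  {θ₀ θ₁ : ℕ → EuclideanSpace ℝ (Fin d)} {r g : 𝒳 → ℝ} {G : ℕ → 𝒳 → ℝ}

/-- If `2 √n (√p_{θ₁} - √p_{θ₀})` and `G √p_{θ₀}` have a common limit in `L²(μ)`, then so do
`√n` times the relative increment and `G` in `L²(p_{θ₀} μ)`. -/
lemma tendsto_eLpNorm_rootIncrement_sub
    (hG : ∀ᶠ n in atTop, AEStronglyMeasurable (fun x => G n x * √(p (θ₀ n) x)) μ)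
    (hp : IsDensityFamily μ Θ p) (h₀ : ∀ n, θ₀ n ∈ Θ) (h₁ : ∀ n, θ₁ n ∈ Θ) (hg : MemLp g 2 μ)
    (hfl : Tendsto (fun n : ℕ => eLpNorm
      ((fun x => 2 * √(n : ℝ) * (√(p (θ₁ n) x) - √(p (θ₀ n) x))) - g) 2 μ) atTop (𝓝 0))
    (hGl : Tendsto (fun n => eLpNorm ((fun x => G n x * √(p (θ₀ n) x)) - g) 2 μ) atTop (𝓝 0)) :
    Tendsto (fun n : ℕ => eLpNorm ((fun x => √(n : ℝ) * rootIncrement p (θ₀ n) (θ₁ n) x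
      * √(p (θ₀ n) x)) - fun x => G n x * √(p (θ₀ n) x)) 2 μ) atTop (𝓝 0) := by
  have lim := hfl.add hGl
  rw [zero_add] at lim
  refine tendsto_of_tendsto_of_tendsto_of_le_of_le' tendsto_const_nhds lim
    (Eventually.of_forall fun _ => zero_le) ?_
  filter_upwards [hG] with n hn
  have hm : AEStronglyMeasurable
      (fun x => 2 * √(n : ℝ) * (√(p (θ₁ n) x) - √(p (θ₀ n) x))) μ :=
    (((hp.measurable_sqrt (h₁ n)).sub (hp.measurable_sqrt (h₀ n))).const_mul
      _).aestronglyMeasurable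
  refine le_trans (eLpNorm_mono fun x => ?_)
    (eLpNorm_sub_le (hm.sub hg.1) (hn.sub hg.1) (by simp))
  simp only [Pi.sub_apply, sub_sub_sub_cancel_right]
  -- On `{p_{θ₀} = 0}` both terms on the left vanish, so mass of `p_{θ₁}` there does no harm to the
  -- bound.
  by_cases hx : √(p (θ₀ n) x) = 0
  · simp only [hx, mul_zero, sub_zero, norm_zero, norm_nonneg]
  · rw [mul_assoc, rootIncrement_mul_sqrt_of_ne_zero hx]
    exact le_of_eq (by congr 1; ring)

lemma tendsto_eLpNorm_rootIncrement
    (hG : ∀ᶠ n in atTop, AEStronglyMeasurable (fun x => G n x * √(p (θ₀ n) x)) μ)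
    (hp : IsDensityFamily μ Θ p) (h₀ : ∀ n, θ₀ n ∈ Θ) (h₁ : ∀ n, θ₁ n ∈ Θ) (hg : MemLp g 2 μ)
    (hfl : Tendsto (fun n : ℕ => eLpNorm
      ((fun x => 2 * √(n : ℝ) * (√(p (θ₁ n) x) - √(p (θ₀ n) x))) - g) 2 μ) atTop (𝓝 0))
    (hGl : Tendsto (fun n => eLpNorm ((fun x => G n x * √(p (θ₀ n) x)) - g) 2 μ) atTop (𝓝 0)) :
    Tendsto (fun n : ℕ => eLpNorm ((fun x => √(n : ℝ) * rootIncrement p (θ₀ n) (θ₁ n) x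
      * √(p (θ₀ n) x)) - g) 2 μ) atTop (𝓝 0) := by
  have lim := (tendsto_eLpNorm_rootIncrement_sub hG hp h₀ h₁ hg hfl hGl).add hGl
  rw [zero_add] at lim
  refine tendsto_of_tendsto_of_tendsto_of_le_of_le' tendsto_const_nhds lim
    (Eventually.of_forall fun _ => zero_le) ?_
  filter_upwards [hG] with n hn
  have hm : AEStronglyMeasurable (fun x => √(n : ℝ) * rootIncrement p (θ₀ n) (θ₁ n) x
      * √(p (θ₀ n) x)) μ :=
    (((hp.measurable_rootIncrement (h₀ n) (h₁ n)).const_mul _).mul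
      (hp.measurable_sqrt (h₀ n))).aestronglyMeasurable
  rw [← sub_add_sub_cancel _ (fun x => G n x * √(p (θ₀ n) x)) g]
  exact eLpNorm_add_le (hm.sub hn) (hn.sub hg.1) (by simp)

/-- The core limit with `a = √n` and `r n = √p_{θ₀ n}`: the weight `(a r)²` is `n` times the
density. -/
lemma tendsto_nat_smul_integral_rootIncrement_comp {E : Type*} [NormedAddCommGroup E]
    [NormedSpace ℝ E] [CompleteSpace E]
    (hp : IsDensityFamily μ Θ p) (h₀ : ∀ n, θ₀ n ∈ Θ) (h₁ : ∀ n, θ₁ n ∈ Θ)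
    (hr : MemLp r 2 μ) (hg : MemLp g 2 μ) (hgr : ∀ x, r x = 0 → g x = 0)
    (hrl : Tendsto (fun n => eLpNorm ((fun x => √(p (θ₀ n) x)) - r) 2 μ) atTop (𝓝 0))
    (hwl : Tendsto (fun n : ℕ => eLpNorm ((fun x => √(n : ℝ) * rootIncrement p (θ₀ n) (θ₁ n) x
      * √(p (θ₀ n) x)) - g) 2 μ) atTop (𝓝 0))
    {F : ℝ → E} {A : E} {C : ℝ} (hF : StronglyMeasurable F) (hFC : ∀ w, ‖F w‖ ≤ C * w ^ 2)
    (hFA : (fun w : ℝ => F w - w ^ 2 • A) =o[𝓝 0] fun w => w ^ 2) :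
    Tendsto (fun n : ℕ => (n : ℝ) • ∫ x, F (rootIncrement p (θ₀ n) (θ₁ n) x)
      ∂(law μ p (θ₀ n))) atTop (𝓝 ((∫ x, g x ^ 2 ∂μ) • A)) := by
  have ha : Tendsto (fun n : ℕ => √(n : ℝ)) atTop atTop :=
    Real.tendsto_sqrt_atTop.comp tendsto_natCast_atTop_atTop
  refine (tendsto_integral_sq_smul_comp ha (fun n => hp.measurable_sqrt (h₀ n))
    (fun n => hp.measurable_rootIncrement (h₀ n) (h₁ n)) hr hg hgr hrl hwl hF hFC hFA).congr
    fun n => ?_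
  rw [hp.integral_law (h₀ n), ← integral_smul]
  simp only [mul_pow, Real.sq_sqrt (Nat.cast_nonneg n), Real.sq_sqrt (hp.nonneg _ (h₀ n) _),
    mul_smul]

lemma tendsto_nat_mul_integral_rootIncrement
    (hp : IsDensityFamily μ Θ p) (h₀ : ∀ n, θ₀ n ∈ Θ) (h₁ : ∀ n, θ₁ n ∈ Θ) (hg : MemLp g 2 μ)
    (hfl : Tendsto (fun n : ℕ => eLpNorm
      ((fun x => 2 * √(n : ℝ) * (√(p (θ₁ n) x) - √(p (θ₀ n) x))) - g) 2 μ) atTop (𝓝 0)) :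
    Tendsto (fun n : ℕ => (n : ℝ) * ∫ x, rootIncrement p (θ₀ n) (θ₁ n) x ∂(law μ p (θ₀ n))) atTop
      (𝓝 (-(1 / 4) * ∫ x, g x ^ 2 ∂μ)) := by
  have hm : ∀ᶠ n : ℕ in atTop, AEStronglyMeasurable
      (fun x => 2 * √(n : ℝ) * (√(p (θ₁ n) x) - √(p (θ₀ n) x))) μ := Eventually.of_forall fun n =>
    (((hp.measurable_sqrt (h₁ n)).sub (hp.measurable_sqrt (h₀ n))).const_mul
      _).aestronglyMeasurable
  have h := (tendsto_integral_mul_of_eLpNorm hm hm hg hg hfl hfl).const_mul (-(1 / 4))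
  simp only [← pow_two] at h
  refine h.congr fun n => ?_
  rw [hp.integral_rootIncrement (h₀ n) (h₁ n)]
  simp only [mul_pow, Real.sq_sqrt (Nat.cast_nonneg n), integral_const_mul]
  ring

end Limits

/-! ### Truncation, characteristic functions and moments. -/

section Expansion

variable {𝒳 : Type*} [MeasurableSpace 𝒳] {d : ℕ} {μ : Measure 𝒳}
  {Θ : Set (EuclideanSpace ℝ (Fin d))} {p : EuclideanSpace ℝ (Fin d) → 𝒳 → ℝ}
  {θ₀ θ₁ : ℕ → EuclideanSpace ℝ (Fin d)} {r g : 𝒳 → ℝ} {G : ℕ → 𝒳 → ℝ}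

/-- The indicator of `1 < |w|` is at most `w²` and vanishes near `0`, so the core limit applies with
`A = 0`. -/
lemma tendsto_nat_mul_measureReal_rootIncrement
    (hp : IsDensityFamily μ Θ p) (h₀ : ∀ n, θ₀ n ∈ Θ) (h₁ : ∀ n, θ₁ n ∈ Θ)
    (hr : MemLp r 2 μ) (hg : MemLp g 2 μ) (hgr : ∀ x, r x = 0 → g x = 0)
    (hrl : Tendsto (fun n => eLpNorm ((fun x => √(p (θ₀ n) x)) - r) 2 μ) atTop (𝓝 0))
    (hwl : Tendsto (fun n : ℕ => eLpNorm ((fun x => √(n : ℝ) * rootIncrement p (θ₀ n) (θ₁ n) x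
      * √(p (θ₀ n) x)) - g) 2 μ) atTop (𝓝 0)) :
    Tendsto (fun n : ℕ => n * (law μ p (θ₀ n)).real {x | 1 < |rootIncrement p (θ₀ n) (θ₁ n) x|})
      atTop (𝓝 0) := by
  have hS : MeasurableSet {w : ℝ | 1 < |w|} := measurableSet_lt measurable_const measurable_id.abs
  have hF : StronglyMeasurable ({w : ℝ | 1 < |w|}.indicator fun _ => (1 : ℝ)) :=
    stronglyMeasurable_const.indicator hS
  have h := tendsto_nat_smul_integral_rootIncrement_comp hp h₀ h₁ hr hg hgr hrl hwl (A := 0)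
    (C := 1) hF ?_ ?_
  · rw [smul_zero] at h
    refine h.congr fun n => ?_
    have hm := hp.measurable_rootIncrement (h₀ n) (h₁ n)
    rw [smul_eq_mul]
    congr 1
    exact integral_indicator_one (hm hS)
  · intro w
    by_cases hw : 1 < |w|
    · rw [Set.indicator_of_mem (by exact hw), norm_one, ← sq_abs]
      nlinarith
    · rw [Set.indicator_of_notMem (by exact hw), norm_zero]
      positivity
  · refine (isLittleO_zero _ _).congr' ?_ EventuallyEq.rfl
    filter_upwards [eventually_abs_le_one] with w hw
    rw [Set.indicator_of_notMem (by exact not_lt.2 hw), smul_zero, sub_zero]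

/-- The limit is the exponent of the Gaussian characteristic function. The linear term `itw` is
removed to obtain a quadratic bound and restored through the exact mean of `w`. -/
lemma tendsto_nat_mul_integral_exp_truncLog
    (hp : IsDensityFamily μ Θ p) (h₀ : ∀ n, θ₀ n ∈ Θ) (h₁ : ∀ n, θ₁ n ∈ Θ)
    (hr : MemLp r 2 μ) (hg : MemLp g 2 μ) (hgr : ∀ x, r x = 0 → g x = 0)
    (hrl : Tendsto (fun n => eLpNorm ((fun x => √(p (θ₀ n) x)) - r) 2 μ) atTop (𝓝 0))
    (hfl : Tendsto (fun n : ℕ => eLpNorm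
      ((fun x => 2 * √(n : ℝ) * (√(p (θ₁ n) x) - √(p (θ₀ n) x))) - g) 2 μ) atTop (𝓝 0))
    (hwl : Tendsto (fun n : ℕ => eLpNorm ((fun x => √(n : ℝ) * rootIncrement p (θ₀ n) (θ₁ n) x
      * √(p (θ₀ n) x)) - g) 2 μ) atTop (𝓝 0)) (t : ℝ) :
    Tendsto (fun n : ℕ => (n : ℂ) * ∫ x,
      (Complex.exp (t * truncLog (rootIncrement p (θ₀ n) (θ₁ n) x) * Complex.I) - 1)
        ∂(law μ p (θ₀ n))) atTop
      (𝓝 (t * (-(1 / 2) * ∫ x, g x ^ 2 ∂μ : ℝ) * Complex.I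
        - (∫ x, g x ^ 2 ∂μ : ℝ) * t ^ 2 / 2)) := by
  have hF : StronglyMeasurable fun w : ℝ =>
      Complex.exp (t * truncLog w * Complex.I) - 1 - t * w * Complex.I := by
    have := measurable_truncLog
    exact Measurable.stronglyMeasurable (by fun_prop)
  have hl := tendsto_nat_smul_integral_rootIncrement_comp hp h₀ h₁ hr hg hgr hrl hwl hF
    (norm_exp_truncLog_sub_le t) (exp_truncLog_isLittleO t)
  have hw := (((tendsto_nat_mul_integral_rootIncrement hp h₀ h₁ hg hfl).ofReal).const_mul
    (t : ℂ)).mul_const Complex.I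
  have h := hl.add hw
  have e : (∫ x, g x ^ 2 ∂μ) • (-(t ^ 2 / 2 : ℂ) - t / 4 * Complex.I)
      + t * ((-(1 / 4) * ∫ x, g x ^ 2 ∂μ : ℝ) : ℂ) * Complex.I
      = t * (-(1 / 2) * ∫ x, g x ^ 2 ∂μ : ℝ) * Complex.I
        - (∫ x, g x ^ 2 ∂μ : ℝ) * t ^ 2 / 2 := by
    rw [Complex.real_smul]
    push_cast
    ring
  rw [e] at h
  refine h.congr fun n => ?_
  have hQ := hp.isProbabilityMeasure_law (h₀ n)
  have hw2 := hp.memLp_rootIncrement (h₀ n) (h₁ n)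
  have hm := hp.measurable_rootIncrement (h₀ n) (h₁ n)
  have hi1 : Integrable (fun x => (t : ℂ) * (rootIncrement p (θ₀ n) (θ₁ n) x : ℂ) * Complex.I)
      (law μ p (θ₀ n)) := ((hw2.integrable (by simp)).ofReal.const_mul _).mul_const _
  have hi2 : Integrable (fun x => Complex.exp
      (t * truncLog (rootIncrement p (θ₀ n) (θ₁ n) x) * Complex.I) - 1
      - t * rootIncrement p (θ₀ n) (θ₁ n) x * Complex.I) (law μ p (θ₀ n)) :=
    (hw2.integrable_sq.const_mul _).mono' (hF.comp_measurable hm).aestronglyMeasurable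
      (Eventually.of_forall fun x => norm_exp_truncLog_sub_le t _)
  have hsplit : ∫ x, (Complex.exp
        (t * truncLog (rootIncrement p (θ₀ n) (θ₁ n) x) * Complex.I) - 1) ∂(law μ p (θ₀ n))
      = (∫ x, (Complex.exp (t * truncLog (rootIncrement p (θ₀ n) (θ₁ n) x) * Complex.I) - 1
          - t * rootIncrement p (θ₀ n) (θ₁ n) x * Complex.I) ∂(law μ p (θ₀ n)))
        + t * ((∫ x, rootIncrement p (θ₀ n) (θ₁ n) x ∂(law μ p (θ₀ n)) : ℝ) : ℂ)
          * Complex.I := by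
    rw [← integral_complex_ofReal, ← integral_const_mul, ← integral_mul_const,
      ← integral_add hi2 hi1]
    simp
  rw [hsplit, Complex.real_smul]
  push_cast
  ring

/-- First and second moments of the difference between the truncated log-likelihood ratio of one
observation and its linear approximation `G / √n`. -/
lemma tendsto_moments_truncLog_sub
    (hp : IsDensityFamily μ Θ p) (h₀ : ∀ n, θ₀ n ∈ Θ) (h₁ : ∀ n, θ₁ n ∈ Θ)
    (hr : MemLp r 2 μ) (hg : MemLp g 2 μ) (hgr : ∀ x, r x = 0 → g x = 0)
    (hrl : Tendsto (fun n => eLpNorm ((fun x => √(p (θ₀ n) x)) - r) 2 μ) atTop (𝓝 0))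
    (hfl : Tendsto (fun n : ℕ => eLpNorm
      ((fun x => 2 * √(n : ℝ) * (√(p (θ₁ n) x) - √(p (θ₀ n) x))) - g) 2 μ) atTop (𝓝 0))
    (hGm : ∀ n, Measurable (G n)) (hG0 : ∀ᶠ n in atTop, ∫ x, G n x ∂(law μ p (θ₀ n)) = 0)
    (hGl : Tendsto (fun n => eLpNorm ((fun x => G n x * √(p (θ₀ n) x)) - g) 2 μ) atTop (𝓝 0)) :
    (∀ᶠ n : ℕ in atTop, MemLp (fun x => truncLog (rootIncrement p (θ₀ n) (θ₁ n) x)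
      - 1 / √(n : ℝ) * G n x) 2 (law μ p (θ₀ n))) ∧
    Tendsto (fun n : ℕ => (n : ℝ) * ∫ x, (truncLog (rootIncrement p (θ₀ n) (θ₁ n) x)
      - 1 / √(n : ℝ) * G n x) ∂(law μ p (θ₀ n))) atTop (𝓝 (-(1 / 2) * ∫ x, g x ^ 2 ∂μ)) ∧
    Tendsto (fun n : ℕ => (n : ℝ) * ∫ x, (truncLog (rootIncrement p (θ₀ n) (θ₁ n) x)
      - 1 / √(n : ℝ) * G n x) ^ 2 ∂(law μ p (θ₀ n))) atTop (𝓝 0) := by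
  set Q : ℕ → Measure 𝒳 := fun n => law μ p (θ₀ n)
  set w : ℕ → 𝒳 → ℝ := fun n => rootIncrement p (θ₀ n) (θ₁ n) with hwdef
  have hQ : ∀ n, IsProbabilityMeasure (Q n) := fun n => hp.isProbabilityMeasure_law (h₀ n)
  have hwm : ∀ n, Measurable (w n) := fun n => hp.measurable_rootIncrement (h₀ n) (h₁ n)
  have hw2 : ∀ n, MemLp (w n) 2 (Q n) := fun n => hp.memLp_rootIncrement (h₀ n) (h₁ n)
  have hGs : ∀ n, AEStronglyMeasurable (fun x => G n x * √(p (θ₀ n) x)) μ := fun n =>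
    ((hGm n).mul (hp.measurable_sqrt (h₀ n))).aestronglyMeasurable
  have hGs' := Eventually.of_forall (f := atTop) hGs
  have hwl := tendsto_eLpNorm_rootIncrement hGs' hp h₀ h₁ hg hfl hGl
  have hwG := tendsto_eLpNorm_rootIncrement_sub hGs' hp h₀ h₁ hg hfl hGl
  have hG2 : ∀ᶠ n in atTop, MemLp (G n) 2 (Q n) := by
    filter_upwards [eventually_memLp_of_tendsto hGs' hg hGl] with n hn
    exact (hp.memLp_law_iff (h₀ n) (hGm n)).2 hn
  have hTm : ∀ n, Measurable fun x => truncLog (w n x) - w n x := fun n =>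
    (measurable_truncLog.comp (hwm n)).sub (hwm n)
  have hT2 : ∀ n, MemLp (fun x => truncLog (w n x) - w n x) 2 (Q n) := fun n =>
    (hw2 n).mono (hTm n).aestronglyMeasurable
      (Eventually.of_forall fun x => abs_truncLog_sub_le (w n x))
  have hwG2 : ∀ᶠ n : ℕ in atTop, MemLp (fun x => w n x - 1 / √(n : ℝ) * G n x) 2 (Q n) := by
    filter_upwards [hG2] with n hn
    exact (hw2 n).sub (hn.const_mul _)
  -- The first bracket is a function of `w` of order `w²`, handled by the core limit; the second is
  -- an `L²` approximation error.
  have e : ∀ n x, truncLog (w n x) - 1 / √(n : ℝ) * G n x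
      = (truncLog (w n x) - w n x) + (w n x - 1 / √(n : ℝ) * G n x) := fun n x => by ring
  have e' : ∀ n x, truncLog (rootIncrement p (θ₀ n) (θ₁ n) x) - 1 / √(n : ℝ) * G n x
      = (truncLog (w n x) - w n x) + (w n x - 1 / √(n : ℝ) * G n x) := e
  have hF1 : StronglyMeasurable fun w : ℝ => truncLog w - w :=
    (measurable_truncLog.sub measurable_id).stronglyMeasurable
  have hT1lim : Tendsto (fun n : ℕ => (n : ℝ) • ∫ x, (truncLog (w n x) - w n x) ∂(Q n)) atTop
      (𝓝 ((∫ x, g x ^ 2 ∂μ) • (-(1 / 4)))) :=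
    tendsto_nat_smul_integral_rootIncrement_comp hp h₀ h₁ hr hg hgr hrl hwl hF1 (C := 1)
      (fun w => by rw [one_mul]; exact abs_truncLog_sub_le_sq w) truncLog_isLittleO
  have hT2lim : Tendsto (fun n : ℕ => (n : ℝ) • ∫ x, (truncLog (w n x) - w n x) ^ 2 ∂(Q n)) atTop
      (𝓝 ((∫ x, g x ^ 2 ∂μ) • (0 : ℝ))) := by
    refine tendsto_nat_smul_integral_rootIncrement_comp hp h₀ h₁ hr hg hgr hrl hwl
      (F := fun w : ℝ => (truncLog w - w) ^ 2) (hF1.pow 2) (C := 1) (fun w => ?_) ?_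
    · rw [one_mul, norm_pow, Real.norm_eq_abs, ← sq_abs w]
      exact pow_le_pow_left₀ (abs_nonneg _) (abs_truncLog_sub_le w) 2
    · simp only [smul_zero, sub_zero]
      have hb : (fun w => (truncLog w - w) ^ 2) =O[𝓝 0] fun w : ℝ => (w ^ 2) ^ 2 :=
        IsBigO.pow (IsBigO.of_bound 1 (Eventually.of_forall fun w => by
          simpa using abs_truncLog_sub_le_sq w)) 2
      refine hb.trans_isLittleO ?_
      simp only [← pow_mul]
      exact isLittleO_pow_pow (by norm_num)
  have hwGlim : Tendsto (fun n : ℕ => (n : ℝ) * ∫ x, (w n x - 1 / √(n : ℝ) * G n x) ^ 2 ∂(Q n)) atTop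
      (𝓝 0) := by
    have hL : ∀ᶠ n : ℕ in atTop, MemLp ((fun x => √(n : ℝ) * rootIncrement p (θ₀ n) (θ₁ n) x
        * √(p (θ₀ n) x)) - fun x => G n x * √(p (θ₀ n) x)) 2 μ := by
      filter_upwards [hwG.eventually_lt_const ENNReal.zero_lt_top] with n hn
      exact ⟨((((hwm n).const_mul _).mul
        (hp.measurable_sqrt (h₀ n))).aestronglyMeasurable).sub (hGs n), hn⟩
    refine ((tendsto_eLpNorm_two_iff_integral_sq hL).1 hwG).congr' ?_
    filter_upwards [eventually_gt_atTop 0] with n hn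
    rw [hp.integral_law_sq (h₀ n), ← integral_const_mul]
    refine integral_congr_ae (Eventually.of_forall fun x => ?_)
    have hn' : √(n : ℝ) ≠ 0 := Real.sqrt_ne_zero'.2 (by exact_mod_cast hn)
    have hsq := Real.sq_sqrt (Nat.cast_nonneg (α := ℝ) n)
    simp only [Pi.sub_apply]
    have e1 : √(n : ℝ) * rootIncrement p (θ₀ n) (θ₁ n) x * √(p (θ₀ n) x)
        - G n x * √(p (θ₀ n) x) = √(n : ℝ) * ((w n x - 1 / √(n : ℝ) * G n x) * √(p (θ₀ n) x)) := by
      simp only [hwdef]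
      field_simp
    rw [e1, mul_pow, hsq]
  refine ⟨?_, ?_, ?_⟩
  · simp only [e']
    filter_upwards [hwG2] with n hn
    exact (hT2 n).add hn
  · have h := hT1lim.add (tendsto_nat_mul_integral_rootIncrement hp h₀ h₁ hg hfl)
    have e2 : (∫ x, g x ^ 2 ∂μ) • (-(1 / 4) : ℝ) + -(1 / 4) * ∫ x, g x ^ 2 ∂μ
        = -(1 / 2) * ∫ x, g x ^ 2 ∂μ := by rw [smul_eq_mul]; ring
    rw [e2] at h
    refine h.congr' ?_
    filter_upwards [hG2, hwG2, hG0] with n h1 h2 h3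
    simp only [e']
    rw [integral_add ((hT2 n).integrable (by simp)) (h2.integrable (by simp)),
      integral_sub ((hw2 n).integrable (by simp)) ((h1.integrable (by simp)).const_mul _),
      integral_const_mul, h3, smul_eq_mul]
    ring
  · have h := (hT2lim.const_mul 2).add (hwGlim.const_mul 2)
    rw [smul_zero, mul_zero, add_zero] at h
    refine squeeze_zero' (Eventually.of_forall fun n =>
      mul_nonneg (Nat.cast_nonneg n) (integral_nonneg fun x => sq_nonneg _)) ?_ h
    filter_upwards [hwG2] with n hn
    have i1 := (hT2 n).integrable_sq.const_mul 2
    have i2 := hn.integrable_sq.const_mul 2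
    have hle : ∫ x, (truncLog (w n x) - 1 / √(n : ℝ) * G n x) ^ 2 ∂(Q n)
        ≤ 2 * (∫ x, (truncLog (w n x) - w n x) ^ 2 ∂(Q n))
          + 2 * ∫ x, (w n x - 1 / √(n : ℝ) * G n x) ^ 2 ∂(Q n) := by
      rw [← integral_const_mul, ← integral_const_mul, ← integral_add i1 i2]
      refine integral_mono_of_nonneg (Eventually.of_forall fun x => sq_nonneg _) (i1.add i2)
        (Eventually.of_forall fun x => ?_)
      simp only [e]
      nlinarith [sq_nonneg ((truncLog (w n x) - w n x) - (w n x - 1 / √(n : ℝ) * G n x))]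
    have := mul_le_mul_of_nonneg_left hle (Nat.cast_nonneg (α := ℝ) n)
    rw [smul_eq_mul]
    linarith

end Expansion

end LocalAsymptotics

/-! ### Local asymptotic normality. -/

theorem mainTheorem3 {𝒳 : Type*} [MeasurableSpace 𝒳] {d : ℕ} (μ : Measure 𝒳)
    (Θ : Set (EuclideanSpace ℝ (Fin d))) (hΘ : IsOpen Θ)
    (p : EuclideanSpace ℝ (Fin d) → 𝒳 → ℝ) (hp : LocalAsymptotics.IsDensityFamily μ Θ p)
    (score : EuclideanSpace ℝ (Fin d) → 𝒳 → EuclideanSpace ℝ (Fin d))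
    (hscore_meas : ∀ θ' ∈ Θ, Measurable (score θ'))
    (θ : EuclideanSpace ℝ (Fin d)) (hθ : θ ∈ Θ)
    (hscore : ∀ᶠ θ' in 𝓝 θ, LocalAsymptotics.HasDQMScore μ p (score θ') θ')
    (hDDQM : LocalAsymptotics.IsDDQM μ p score θ)
    (h h' : ℕ → EuclideanSpace ℝ (Fin d)) (k : EuclideanSpace ℝ (Fin d))
    (hhΘ : ∀ n, θ + h n ∈ Θ) (hh'Θ : ∀ n, θ + h' n ∈ Θ)
    (hh : Tendsto h atTop (𝓝 0)) (hh' : Tendsto h' atTop (𝓝 0))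
    (hk : Tendsto (fun n : ℕ => √(n : ℝ) • (h n - h' n)) atTop (𝓝 k))
    {Ω : ℕ → Type*} [∀ n, MeasurableSpace (Ω n)] (P : ∀ n, Measure (Ω n))
    [∀ n, IsProbabilityMeasure (P n)]
    (X : ∀ n, Fin n → Ω n → 𝒳)
    (hX_indep : ∀ n, iIndepFun (X n) (P n))
    (hX_law : ∀ n i, HasLaw (X n i) (LocalAsymptotics.law μ p (θ + h' n)) (P n)) :
    Tendsto (fun n => P n {ω | ∀ i, 0 < p (θ + h n) (X n i ω) ∧ 0 < p (θ + h' n) (X n i ω)})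
        atTop (𝓝 1) ∧
    LocalAsymptotics.IsLittleOInProb P (fun n ω =>
      LocalAsymptotics.logLik p (fun i => X n i ω) (θ + h n)
        - LocalAsymptotics.logLik p (fun i => X n i ω) (θ + h' n)
        - ((1 / √(n : ℝ))
              * inner ℝ k (LocalAsymptotics.sampleScore score (fun i => X n i ω) (θ + h' n))
            - (1 / 2) * LocalAsymptotics.quadForm (LocalAsymptotics.fisherInfo μ p score θ) k)) ∧
    TendstoInDistribution
      (fun n ω => LocalAsymptotics.logLik p (fun i => X n i ω) (θ + h n)
        - LocalAsymptotics.logLik p (fun i => X n i ω) (θ + h' n))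
      atTop id P
      (gaussianReal (-(1 / 2) * LocalAsymptotics.quadForm (LocalAsymptotics.fisherInfo μ p score θ) k)
        (LocalAsymptotics.quadForm (LocalAsymptotics.fisherInfo μ p score θ) k).toNNReal) := by
  have hDθ := hscore.self_of_nhds
  have hsθ := hscore_meas θ hθ
  set r : 𝒳 → ℝ := fun x => √(p θ x) with hrdef
  set g : 𝒳 → ℝ := fun x => inner ℝ k (score θ x) * √(p θ x) with hgdef
  set σ2 : ℝ := LocalAsymptotics.quadForm (LocalAsymptotics.fisherInfo μ p score θ) k
  have hσ : σ2 = ∫ x, g x ^ 2 ∂μ := hDθ.quadForm_fisherInfo hp hΘ hθ hsθ k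
  have hσ0 : 0 ≤ σ2 := hσ ▸ integral_nonneg fun x => sq_nonneg _
  have hr : MemLp r 2 μ := hp.memLp_sqrt hθ
  have hg : MemLp g 2 μ := hDθ.memLp_inner hp hΘ hθ hsθ k
  have hgr : ∀ x, r x = 0 → g x = 0 := fun x hx => by
    simp only [hrdef] at hx
    simp only [hgdef, hx, mul_zero]
  have hrl := hDθ.tendsto_sqrt hp hΘ hθ hsθ hh'
  have hfl := hDDQM.tendsto_sqrt_sub hp hΘ hθ hscore_meas hDθ hh hh' hk
  set G : ℕ → 𝒳 → ℝ := fun n x => inner ℝ k (score (θ + h' n) x) with hGdef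
  have hGm : ∀ n, Measurable (G n) := fun n => measurable_const.inner (hscore_meas _ (hh'Θ n))
  have hGl : Tendsto (fun n => eLpNorm ((fun x => G n x * √(p (θ + h' n) x)) - g) 2 μ) atTop
      (𝓝 0) := hDDQM.tendsto_score hp hΘ hθ hscore_meas hDθ hh' tendsto_const_nhds
  have hθ' : Tendsto (fun n => θ + h' n) atTop (𝓝 θ) := by simpa using hh'.const_add θ
  -- Differentiability at points other than `θ` enters only here, to centre the score at `θ + h' n`.
  have hG0 : ∀ᶠ n in atTop, ∫ x, G n x ∂(LocalAsymptotics.law μ p (θ + h' n)) = 0 := by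
    filter_upwards [hθ'.eventually hscore] with n hn
    exact hn.integral_inner_eq_zero hp hΘ (hh'Θ n) (hscore_meas _ (hh'Θ n)) k
  have hwl := LocalAsymptotics.tendsto_eLpNorm_rootIncrement (Eventually.of_forall fun n =>
    ((hGm n).mul (hp.measurable_sqrt (hh'Θ n))).aestronglyMeasurable) hp hh'Θ hhΘ hg hfl hGl
  have hQ : ∀ n, IsProbabilityMeasure (LocalAsymptotics.law μ p (θ + h' n)) := fun n =>
    hp.isProbabilityMeasure_law (hh'Θ n)
  set w : ℕ → 𝒳 → ℝ := fun n => LocalAsymptotics.rootIncrement p (θ + h' n) (θ + h n) with hw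
  have hwm : ∀ n, Measurable (w n) := fun n => hp.measurable_rootIncrement (hh'Θ n) (hhΘ n)
  have hTm : ∀ n, Measurable fun x => LocalAsymptotics.truncLog (w n x) := fun n =>
    LocalAsymptotics.measurable_truncLog.comp (hwm n)
  -- Off this event all densities are positive and truncation changes nothing; its probability tends
  -- to `0`, which makes the value of `log 0` immaterial.
  set D : ∀ n, Set (Ω n) := fun n => {ω | ∃ i, X n i ω ∈ {x | 1 < |w n x|}} with hD
  have hDlim : Tendsto (fun n => P n (D n)) atTop (𝓝 0) :=
    LocalAsymptotics.tendsto_measure_exists_mem hX_law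
      (fun n => measurableSet_lt measurable_const (hwm n).abs)
      (LocalAsymptotics.tendsto_nat_mul_measureReal_rootIncrement hp hh'Θ hhΘ hr hg hgr hrl hwl)
  have hDle : ∀ n, ∀ ω ∉ D n, ∀ i, |w n (X n i ω)| ≤ 1 := fun n ω hω i =>
    not_lt.1 fun hi => hω ⟨i, hi⟩
  have hlog : ∀ n, ∀ ω ∉ D n,
      LocalAsymptotics.logLik p (fun i => X n i ω) (θ + h n)
        - LocalAsymptotics.logLik p (fun i => X n i ω) (θ + h' n)
      = ∑ i, LocalAsymptotics.truncLog (w n (X n i ω)) := fun n ω hω => by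
    simp only [LocalAsymptotics.logLik, ← Finset.sum_sub_distrib]
    exact Finset.sum_congr rfl fun i _ =>
      (LocalAsymptotics.truncLog_rootIncrement (hDle n ω hω i)).symm
  refine ⟨?_, ?_, ?_⟩
  · have hlim : Tendsto (fun n => 1 - P n (D n)) atTop (𝓝 1) := by
      simpa using ENNReal.Tendsto.sub tendsto_const_nhds hDlim (Or.inl ENNReal.one_ne_top)
    refine tendsto_of_tendsto_of_tendsto_of_le_of_le hlim tendsto_const_nhds (fun n => ?_)
      fun n => prob_le_one
    -- Subadditivity avoids complements, as `D n` need not be measurable when the `X n i` are only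
    -- almost everywhere measurable.
    rw [tsub_le_iff_right, ← measure_univ (μ := P n)]
    refine (measure_mono fun ω _ => ?_).trans (measure_union_le _ (D n))
    by_cases hω : ω ∈ D n
    · exact Or.inr hω
    · exact Or.inl fun i =>
        (LocalAsymptotics.pos_of_abs_rootIncrement_le_one (hDle n ω hω i)).symm
  · obtain ⟨hZ2, hZ1lim, hZ2lim⟩ := LocalAsymptotics.tendsto_moments_truncLog_sub hp hh'Θ hhΘ hr hg
      hgr hrl hfl hGm hG0 hGl
    refine (LocalAsymptotics.isLittleOInProb_sum_sub hX_indep hX_law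
      (fun n => (hTm n).sub ((hGm n).const_mul _)) hZ2 hZ1lim hZ2lim).congr_of_tendsto hDlim
      fun n ω hω => ?_
    rw [hlog n ω hω, ← hσ, LocalAsymptotics.sampleScore, inner_sum, Finset.mul_sum]
    simp only [Pi.sub_apply, Finset.sum_sub_distrib, hGdef]
    ring
  · have hTs : ∀ n, AEMeasurable (fun ω => ∑ i, LocalAsymptotics.truncLog (w n (X n i ω))) (P n) :=
      fun n => Finset.aemeasurable_fun_sum _ fun i _ =>
        (hTm n).comp_aemeasurable (hX_law n i).aemeasurable
    have hlm : ∀ n, AEMeasurable (fun ω => LocalAsymptotics.logLik p (fun i => X n i ω) (θ + h n)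
        - LocalAsymptotics.logLik p (fun i => X n i ω) (θ + h' n)) (P n) := fun n =>
      (Finset.aemeasurable_fun_sum _ fun i _ => (hp.measurable _ (hhΘ n)).log.comp_aemeasurable
        (hX_law n i).aemeasurable).sub (Finset.aemeasurable_fun_sum _ fun i _ =>
        (hp.measurable _ (hh'Θ n)).log.comp_aemeasurable (hX_law n i).aemeasurable)
    refine ⟨hlm, aemeasurable_id, ?_⟩
    -- Lévy's continuity theorem, which covers the degenerate case `σ2 = 0` as well.
    refine ProbabilityMeasure.tendsto_iff_tendsto_charFun.2 fun t => ?_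
    have h1 := LocalAsymptotics.tendsto_charFun_sum hX_indep hX_law hTm
      (LocalAsymptotics.tendsto_nat_mul_integral_exp_truncLog hp hh'Θ hhΘ hr hg hgr hrl hfl hwl t)
    have h2 : Tendsto (fun n =>
        charFun ((P n).map fun ω => LocalAsymptotics.logLik p (fun i => X n i ω) (θ + h n)
          - LocalAsymptotics.logLik p (fun i => X n i ω) (θ + h' n)) t
        - charFun ((P n).map fun ω => ∑ i, LocalAsymptotics.truncLog (w n (X n i ω))) t) atTop
        (𝓝 0) := by
      have h3 := ((ENNReal.tendsto_toReal ENNReal.zero_ne_top).comp hDlim).const_mul 2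
      rw [ENNReal.toReal_zero, mul_zero] at h3
      exact squeeze_zero_norm (fun n => LocalAsymptotics.norm_charFun_map_sub_le (hlm n) (hTs n)
        (hlog n) t) h3
    have h4 := h2.add h1
    simp only [sub_add_cancel, zero_add] at h4
    simp only [ProbabilityMeasure.coe_mk, Measure.map_id]
    rw [charFun_gaussianReal, Real.coe_toNNReal _ hσ0]
    rw [← hσ] at h4
    exact h4
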